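/- **Setting.** Let $\mathcal S,\mathcal A$ be finite nonempty sets, $p^a_s\in\Delta(\mathcal S)$ a transition kernel, $c:\mathcal S\times\mathcal A\to[0,1]$ a cost, $\gamma\in[0,1)$ a discount factor, $R\in[0,1]$, and $\rho\in\Delta(\mathcal S)$ an initial distribution with $\rho_{\min}=\min_s\rho(s)>0$. Let $\mathcal P=\prod_{s,a}\{(1-R)p^a_s+Rq: q\in\Delta(\mathcal S)\}$ be the $R$-contamination set. For a stationary policy $\pi$, the robust value function is $V^\pi(s)=\max_{\kappa}\mathbb E_\kappa[\sum_{t\ge0}\gamma^t c(S_t,A_t)\mid S_0=s,\pi]$, with the maximum over all sequences $\kappa=(\mathsf P_0,\mathsf P_1,\dots)$ of kernels $\mathsf P_t\in\mathcal P$. Policies are parametrized directly: $\Theta=\Delta(\mathcal A)^{\mathcal S}\subset\mathbb R^{\mathcal S\times\mathcal A}$ and $\pi_\theta(a|s)=\theta_{s,a}$. Put $J(\theta)=\sum_s\rho(s)V^{\pi_\theta}(s)$ and $J^*=\min_{\theta\in\Theta}J(\theta)$. For $\sigma>0$ let $\mathrm{LSE}(\sigma,V)=\frac1\sigma\log\sum_{s}e^{\sigma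 V(s)}$, let $V_\sigma^\pi$ be the unique fixed point of $V\mapsto\big(s\mapsto\sum_a\pi(a|s)[c(s,a)+\gamma(1-R)\sum_{s'}p^a_s(s')V(s')+\gamma R\,\mathrm{LSE}(\sigma,V)]\big)$, and let $J_\sigma(\theta)=\sum_s\rho(s)V_\sigma^{\pi_\theta}(s)$, extended by the same formula to a neighbourhood of $\Theta$ in $\mathbb R^{\mathcal S\times\mathcal A}$. With the Euclidean projection $\Pi_\Theta$ onto $\Theta$, smoothed robust policy gradient with step size $\alpha$ and starting point $\theta_0\in\Theta$ is the iteration $\theta_{t+1}=\Pi_\Theta(\theta_t-\alpha\nabla J_\sigma(\theta_t))$. Let $k_\pi$ and $l_\pi\ge0$ be constants with $\|\nabla\pi_\theta(a|s)\|\le k_\pi$ and $\|\nabla\pi_{\theta_1}(a|s)-\nabla\pi_{\theta_2}(a|s)\|\le l_\pi\|\theta_1-\theta_2\|$ for all $s,a$ and $\theta,\theta_1,\theta_2\in\Theta$ (so $k_\pi=1$, $l_\pi=0$ are admissible), and set $$C_{PL}=\frac1{(1-\gamma)\rho_{\min}},\quad C_\sigma=\frac1{1-\gamma}\Big(1+2\gamma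 R\frac{\log|\mathcal S|}{\sigma}\Big),\quad C^V_\sigma=\frac{|\mathcal A|k_\pi C_\sigma}{1-\gamma},$$ $$k_B=\frac{|\mathcal A|C_\sigma l_\pi+|\mathcal A|k_\pi C_\sigma^V}{1-\gamma+\gamma R}+\frac{2|\mathcal A|^2\gamma(1-R)}{(1-\gamma+\gamma R)^2}k_\pi^2C_\sigma,$$ $$L_\sigma=k_B+\frac{\gamma R}{1-\gamma}\Big(\sqrt{|\mathcal S|}\,k_B+\frac{2\sigma|\mathcal S|C_\sigma^Vk_\pi|\mathcal A|C_\sigma}{1-\gamma+\gamma R}\Big).$$ **Theorem.** For $\epsilon>0$ let $$\sigma=\frac{2\gamma R\log|\mathcal S|}{\epsilon(1-\gamma)}\qquad\text{and}\qquad T=\Big\lceil\frac{64|\mathcal S|C_{PL}^2L_\sigma C_\sigma}{\epsilon^2}\Big\rceil ;$$ if $\gamma R\log|\mathcal S|=0$, in which case $V_\sigma^\pi$ does not depend on $\sigma$, let instead $\sigma$ be an arbitrary positive number independent of $\epsilon$. Then for every $\epsilon>0$ and every $\theta_0\in\Theta$, the iterates of smoothed robust policy gradient with step size $1/L_\sigma$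 satisfy $$\min_{0\le t\le T-1}J(\theta_t)-J^*\le3\epsilon .$$ Moreover $\sigma=\mathcal O(\epsilon^{-1})$ and $T=\mathcal O(\epsilon^{-3})$ as $\epsilon\to0^+$, for fixed data $\mathcal S,\mathcal A,p,c,\gamma,R,\rho,k_\pi,l_\pi$. -/

import Mathlib

open Filter Topology Asymptotics

noncomputable section

namespace RobustPG

/-- A finite Markov decision process with costs in `[0,1]`, discount factor `γ ∈ [0,1)`, centre
transition kernel `p`, and contamination level `R ∈ [0,1]`. -/
structure RobustMDP (S A : Type*) [Fintype S] where
  p : S → A → S → ℝ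
  p_mem : ∀ s a, p s a ∈ stdSimplex ℝ S
  c : S → A → ℝ
  c_mem : ∀ s a, c s a ∈ Set.Icc (0 : ℝ) 1
  γ : ℝ
  γ_nonneg : 0 ≤ γ
  γ_lt_one : γ < 1
  R : ℝ
  R_nonneg : 0 ≤ R
  R_le_one : R ≤ 1

variable {S A : Type*} [Fintype S] [Fintype A]

/-! ### The robust value function -/

/-- The `R`-contamination uncertainty set `∏_{s,a} {(1-R) p^a_s + R q : q ∈ Δ(S)}`. -/
def RobustMDP.uncertaintySet (M : RobustMDP S A) : Set (S → A → S → ℝ) :=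
  {P | ∀ s a, ∃ q ∈ stdSimplex ℝ S, P s a = (1 - M.R) • M.p s a + M.R • q}

open Classical in
/-- `stateDist π κ s t s'` is the probability of `S_t = s'` when `S_0 = s`, the agent follows the
stationary policy `π`, and the transition at time `t` is made with the kernel `κ t`. -/
def stateDist (π : S → A → ℝ) (κ : ℕ → S → A → S → ℝ) (s : S) : ℕ → S → ℝ
  | 0 => Pi.single s 1
  | t + 1 => fun s' => ∑ x, ∑ a, stateDist π κ s t x * π x a * κ t x a s'

/-- The expected discounted cost `E_κ[∑_t γ^t c(S_t, A_t) | S_0 = s, π]`. -/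
def RobustMDP.discountedCost (M : RobustMDP S A) (π : S → A → ℝ) (κ : ℕ → S → A → S → ℝ)
    (s : S) : ℝ :=
  ∑' t : ℕ, M.γ ^ t * ∑ x, ∑ a, stateDist π κ s t x * π x a * M.c x a

/-- The robust value function: the worst case over all sequences `κ = (P_0, P_1, …)` of kernels
from the uncertainty set. -/
def RobustMDP.robustValue (M : RobustMDP S A) (π : S → A → ℝ) (s : S) : ℝ :=
  ⨆ κ : {κ : ℕ → S → A → S → ℝ // ∀ t, κ t ∈ M.uncertaintySet}, M.discountedCost π κ.1 s

/-! ### The smoothed robust value function -/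

/-- `LSE(σ, V) = log (∑_s exp (σ V(s))) / σ`. -/
def LSE (σ : ℝ) (V : S → ℝ) : ℝ :=
  Real.log (∑ s, Real.exp (σ * V s)) / σ

/-- The smoothed robust Bellman operator of `π`. -/
def RobustMDP.smoothedBellman (M : RobustMDP S A) (σ : ℝ) (π : S → A → ℝ) (V : S → ℝ) : S → ℝ :=
  fun s => ∑ a, π s a *
    (M.c s a + M.γ * (1 - M.R) * ∑ s', M.p s a s' * V s' + M.γ * M.R * LSE σ V)

/-- The smoothed robust value function `V^π_σ`: the fixed point of the smoothed Bellman operator.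
For a policy `π`, and for all arrays `π` in a neighbourhood of the set of policies, the operator is
a contraction for the maximum norm, so that the fixed point exists and is unique. -/
def RobustMDP.smoothedValue (M : RobustMDP S A) (σ : ℝ) (π : S → A → ℝ) : S → ℝ :=
  Classical.epsilon fun V => Function.IsFixedPt (M.smoothedBellman σ π) V

/-! ### Policy classes and direct parametrization -/

/-- The class `{π_θ : θ ∈ Θ}` is differentiable and `k`-Lipschitz. -/
def IsLipschitzPolicyClass {E : Type*} [NormedAddCommGroup E] [InnerProductSpace ℝ E]
    [CompleteSpace E] (Θ : Set E) (π : E → S → A → ℝ) (k : ℝ) : Prop :=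
  ∀ s a, ∀ θ ∈ Θ, DifferentiableAt ℝ (fun η => π η s a) θ ∧
    ‖gradient (fun η => π η s a) θ‖ ≤ k

/-- The class `{π_θ : θ ∈ Θ}` is `l`-smooth. -/
def IsSmoothPolicyClass {E : Type*} [NormedAddCommGroup E] [InnerProductSpace ℝ E]
    [CompleteSpace E] (Θ : Set E) (π : E → S → A → ℝ) (l : ℝ) : Prop :=
  0 ≤ l ∧ ∀ s a, ∀ θ₁ ∈ Θ, ∀ θ₂ ∈ Θ,
    ‖gradient (fun η => π η s a) θ₁ - gradient (fun η => π η s a) θ₂‖ ≤ l * ‖θ₁ - θ₂‖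

/-- The parameter set `Θ = Δ(A)^S`, as a subset of Euclidean space. -/
def directParams (S A : Type*) [Fintype S] [Fintype A] : Set (EuclideanSpace ℝ (S × A)) :=
  {θ | ∀ s, (fun a => θ (s, a)) ∈ stdSimplex ℝ A}

/-- Direct parametrization: `π_θ(a|s) = θ_{s,a}`. -/
def directPolicy (θ : EuclideanSpace ℝ (S × A)) : S → A → ℝ :=
  fun s a => θ (s, a)

/-- `J(θ) = ∑_s ρ(s) V^{π_θ}(s)`. -/
def RobustMDP.J (M : RobustMDP S A) (ρ : S → ℝ) (θ : EuclideanSpace ℝ (S × A)) : ℝ :=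
  ∑ s, ρ s * M.robustValue (directPolicy θ) s

/-- `J^* = min_{θ ∈ Θ} J(θ)`. -/
def RobustMDP.JStar (M : RobustMDP S A) (ρ : S → ℝ) : ℝ :=
  sInf (M.J ρ '' directParams S A)

/-- `J_σ(θ) = ∑_s ρ(s) V_σ^{π_θ}(s)`. -/
def RobustMDP.Jσ (M : RobustMDP S A) (ρ : S → ℝ) (σ : ℝ) (θ : EuclideanSpace ℝ (S × A)) : ℝ :=
  ∑ s, ρ s * M.smoothedValue σ (directPolicy θ) s

/-! ### The algorithm -/

/-- The projection onto `K`: a point of `K` nearest to `x` (unique for `K` nonempty, closed and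
convex). -/
def proj {E : Type*} [NormedAddCommGroup E] (K : Set E) (x : E) : E :=
  Classical.epsilon fun y => y ∈ K ∧ ∀ z ∈ K, ‖x - y‖ ≤ ‖x - z‖

/-- Smoothed robust policy gradient with constant step size `α`, started at `θ₀`:
`θ_{t+1} = Π_Θ (θ_t - α ∇J_σ(θ_t))`. -/
def RobustMDP.srpg (M : RobustMDP S A) (ρ : S → ℝ) (σ α : ℝ) (θ₀ : EuclideanSpace ℝ (S × A)) :
    ℕ → EuclideanSpace ℝ (S × A)
  | 0 => θ₀
  | t + 1 => proj (directParams S A)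
      (M.srpg ρ σ α θ₀ t - α • gradient (M.Jσ ρ σ) (M.srpg ρ σ α θ₀ t))

/-! ### The constants -/

/-- `C_PL = 1 / ((1-γ) ρ_min)`. -/
def RobustMDP.CPL (M : RobustMDP S A) (ρ : S → ℝ) : ℝ :=
  1 / ((1 - M.γ) * ⨅ s, ρ s)

/-- `C_σ = (1 + 2γR log|S| / σ) / (1-γ)`. -/
def RobustMDP.Cσ (M : RobustMDP S A) (σ : ℝ) : ℝ :=
  1 / (1 - M.γ) * (1 + 2 * M.γ * M.R * (Real.log (Fintype.card S) / σ))

/-- `C^V_σ = |A| k C_σ / (1-γ)`. -/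
def RobustMDP.CVσ (M : RobustMDP S A) (k σ : ℝ) : ℝ :=
  1 / (1 - M.γ) * Fintype.card A * k * M.Cσ σ

/-- The constant `k_B`. -/
def RobustMDP.kB (M : RobustMDP S A) (k l σ : ℝ) : ℝ :=
  1 / (1 - M.γ + M.γ * M.R) *
      (Fintype.card A * M.Cσ σ * l + Fintype.card A * k * M.CVσ k σ) +
    2 * (Fintype.card A : ℝ) ^ 2 * M.γ * (1 - M.R) / (1 - M.γ + M.γ * M.R) ^ 2 * k ^ 2 * M.Cσ σ

/-- The smoothness constant `L_σ` of `J_σ`. -/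
def RobustMDP.Lσ (M : RobustMDP S A) (k l σ : ℝ) : ℝ :=
  M.kB k l σ + M.γ * M.R / (1 - M.γ) *
    (Real.sqrt (Fintype.card S) * M.kB k l σ +
      2 * σ * Fintype.card S * M.CVσ k σ * (1 / (1 - M.γ + M.γ * M.R)) * k *
        Fintype.card A * M.Cσ σ)

/-- The smoothing parameter `σ = 2γR log|S| / (ε(1-γ))`. In the degenerate case
`γR log|S| = 0`, where this formula does not give an admissible (positive) parameter and where
`V^π_σ` does not depend on `σ`, it is an arbitrary fixed number `σ₀`. -/
def RobustMDP.smoothing (M : RobustMDP S A) (σ₀ ε : ℝ) : ℝ :=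
  open Classical in
  if M.γ * M.R * Real.log (Fintype.card S) = 0 then σ₀
  else 2 * M.γ * M.R * Real.log (Fintype.card S) / (ε * (1 - M.γ))

/-- The number of iterations `T = 64 |S| C_PL² L_σ C_σ / ε²`, rounded up to an integer. -/
def RobustMDP.iterations (M : RobustMDP S A) (ρ : S → ℝ) (k l σ ε : ℝ) : ℕ :=
  ⌈64 * Fintype.card S * M.CPL ρ ^ 2 * M.Lσ k l σ * M.Cσ σ / ε ^ 2⌉₊

end RobustPG

end

/-! Both the maximum and log-sum-exp commute with adding a constant, so the contamination term of
the Bellman equation only shifts the value function. Let B be the nominal value of π, for the centre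
kernel and discount β = γ(1-R), and let w = γR/(1-γ). Then the robust value is B + w max B
(`robustValue_eq`) and the smoothed value is B + w LSE(σ, B) (`smoothedValue_eq`). Hence J ≤ J_σ ≤ J
+ w log|S|/σ on policies, and σ is chosen to make this bias at most ε/2.

On policies J_σ is thus a convex function of B whose derivative is ν = ρ + w·softmax ≥ ρ. Convexity
bounds a gap in J_σ by a ν-weighted gap in B. The performance difference formula bounds that by the
one-step gain of the greedy policy ψ, and ν ≥ ρ ≥ ρ_min relates this gain to the derivative of J_σ
in the direction π - ψ. The result is gradient dominance with constant C_PL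
(`smoothedObjective_sub_le_slope`). Hoeffding's lemma controls the curvature of LSE; together with a
second-order resolvent expansion of B it yields a quadratic remainder on Θ (`abs_Jσ_remainder_le`),
with a coefficient at most L_σ/2 (`Lσ_bounds`).

A projected gradient step minimizes the quadratic model over Θ, so it does at least as well as a
partial move towards ψ (`Jσ_srpg_succ_le`). While the gap exceeds ε, the best such move lowers J_σ
by ε²/(4|S| L_σ C_PL²). As 0 ≤ J_σ ≤ C_σ, this cannot go on for T steps (`exists_Jσ_srpg_sub_le`).
For the rates, C_σ stays bounded as ε → 0 while L_σ grows like σ. -/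

noncomputable section

namespace RobustPG

section

variable {S A : Type*} [Fintype S]

/-! ### Log-sum-exp -/

/-- The softmax weights, i.e. the gradient of `LSE σ` at `V`. -/
def softmax (σ : ℝ) (V : S → ℝ) (s : S) : ℝ :=
  Real.exp (σ * V s) / ∑ s', Real.exp (σ * V s')

lemma sum_exp_pos [Nonempty S] (V : S → ℝ) : 0 < ∑ s, Real.exp (V s) :=
  Finset.sum_pos (fun _ _ => Real.exp_pos _) Finset.univ_nonempty

lemma softmax_mem [Nonempty S] (σ : ℝ) (V : S → ℝ) : softmax σ V ∈ stdSimplex ℝ S := by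
  have h := sum_exp_pos fun s => σ * V s
  refine ⟨fun s => div_nonneg (Real.exp_pos _).le h.le, ?_⟩
  simp only [softmax]
  rw [← Finset.sum_div, div_self h.ne']

lemma LSE_add_const [Nonempty S] {σ : ℝ} (hσ : 0 < σ) (V : S → ℝ) (b : ℝ) :
    LSE σ (fun s => V s + b) = LSE σ V + b := by
  have h := sum_exp_pos fun s => σ * V s
  have e : ∑ s, Real.exp (σ * (V s + b)) = (∑ s, Real.exp (σ * V s)) * Real.exp (σ * b) := by
    rw [Finset.sum_mul]
    exact Finset.sum_congr rfl fun s _ => by rw [mul_add, Real.exp_add]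
  rw [LSE, e, Real.log_mul h.ne' (Real.exp_pos _).ne', Real.log_exp, LSE]
  field_simp

/-- Factoring out e^{σV} leaves a log-moment generating function of W - V under the softmax weights:
Jensen bounds it from below, Hoeffding from above. -/
lemma LSE_sub_LSE [Nonempty S] (σ : ℝ) (V W : S → ℝ) :
    LSE σ W - LSE σ V = Real.log (∑ s, softmax σ V s * Real.exp (σ * (W s - V s))) / σ := by
  have h := sum_exp_pos fun s => σ * V s
  have h' := sum_exp_pos fun s => σ * W s
  have e : ∑ s, softmax σ V s * Real.exp (σ * (W s - V s)) =
      (∑ s, Real.exp (σ * W s)) / ∑ s, Real.exp (σ * V s) := by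
    rw [Finset.sum_div]
    refine Finset.sum_congr rfl fun s _ => ?_
    rw [softmax, div_mul_eq_mul_div, ← Real.exp_add]
    congr 2
    ring
  rw [e, Real.log_div h'.ne' h.ne', LSE, LSE]
  ring

/-- Convexity of log-sum-exp, as a supporting hyperplane. -/
lemma LSE_ge_linear [Nonempty S] {σ : ℝ} (hσ : 0 < σ) (V W : S → ℝ) :
    ∑ s, softmax σ V s * (W s - V s) ≤ LSE σ W - LSE σ V := by
  have hm := softmax_mem σ V
  have hJ := convexOn_exp.map_sum_le (t := Finset.univ) (w := softmax σ V)
    (p := fun s => σ * (W s - V s)) (fun s _ => hm.1 s) hm.2 (fun _ _ => Set.mem_univ _)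
  simp only [smul_eq_mul] at hJ
  rw [LSE_sub_LSE, le_div_iff₀ hσ, Real.le_log_iff_exp_le ((Real.exp_pos _).trans_le hJ)]
  refine le_trans (le_of_eq ?_) hJ
  rw [Finset.sum_mul]
  congr 1
  exact Finset.sum_congr rfl fun s _ => by ring

lemma LSE_mono [Nonempty S] {σ : ℝ} (hσ : 0 < σ) {V W : S → ℝ} (h : ∀ s, V s ≤ W s) :
    LSE σ V ≤ LSE σ W := by
  have := LSE_ge_linear hσ V W
  have h0 : 0 ≤ ∑ s, softmax σ V s * (W s - V s) :=
    Finset.sum_nonneg fun s _ => mul_nonneg ((softmax_mem σ V).1 s) (sub_nonneg.2 (h s))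
  linarith

/-- A monotone functional that commutes with adding constants is 1-Lipschitz for the maximum norm.
-/
lemma abs_LSE_sub_LSE_le [Nonempty S] {σ : ℝ} (hσ : 0 < σ) (V W : S → ℝ) :
    |LSE σ V - LSE σ W| ≤ ‖V - W‖ := by
  have key : ∀ V W : S → ℝ, LSE σ V - LSE σ W ≤ ‖V - W‖ := fun V W => by
    rw [sub_le_iff_le_add', ← LSE_add_const hσ]
    refine LSE_mono hσ fun s => ?_
    have := (le_abs_self _).trans (norm_le_pi_norm (V - W) s)
    simp only [Pi.sub_apply] at this
    linarith
  rw [abs_le]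
  have := key W V
  rw [norm_sub_rev] at this
  exact ⟨by linarith, key V W⟩

lemma le_LSE {σ : ℝ} (hσ : 0 < σ) (V : S → ℝ) (s : S) : V s ≤ LSE σ V := by
  have h : Real.exp (σ * V s) ≤ ∑ s, Real.exp (σ * V s) :=
    Finset.single_le_sum (f := fun s => Real.exp (σ * V s)) (fun _ _ => (Real.exp_pos _).le)
      (Finset.mem_univ s)
  rw [LSE, le_div_iff₀ hσ, Real.le_log_iff_exp_le ((Real.exp_pos _).trans_le h), mul_comm]
  exact h

lemma LSE_le_of_le [Nonempty S] {σ : ℝ} (hσ : 0 < σ) {V : S → ℝ} {b : ℝ} (h : ∀ s, V s ≤ b) :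
    LSE σ V ≤ b + Real.log (Fintype.card S) / σ := by
  refine (LSE_mono hσ h).trans (le_of_eq ?_)
  have : (Fintype.card S : ℝ) ≠ 0 := by exact_mod_cast Fintype.card_ne_zero
  rw [LSE, Finset.sum_const, Finset.card_univ, nsmul_eq_mul,
    Real.log_mul this (Real.exp_pos _).ne', Real.log_exp]
  field_simp
  ring

/-- Hoeffding's lemma for a finite distribution. -/
lemma sum_mul_exp_le {m : S → ℝ} (hm : m ∈ stdSimplex ℝ S) {x : S → ℝ} {b : ℝ}
    (hx : ∀ s, |x s| ≤ b) :
    ∑ s, m s * Real.exp (x s) ≤ Real.exp (∑ s, m s * x s + b ^ 2 / 2) := by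
  let _ : MeasurableSpace S := ⊤
  let P : PMF S := PMF.ofFintype (fun s => ENNReal.ofReal (m s)) (by
    rw [← ENNReal.ofReal_sum_of_nonneg fun s _ => hm.1 s, hm.2, ENNReal.ofReal_one])
  have hP : ∀ f : S → ℝ, ∫ s, f s ∂P.toMeasure = ∑ s, m s * f s := fun f => by
    rw [PMF.integral_eq_sum]
    exact Finset.sum_congr rfl fun s _ => by
      simp [P, ENNReal.toReal_ofReal (hm.1 s)]
  have h := (ProbabilityTheory.hasSubgaussianMGF_of_mem_Icc (μ := P.toMeasure) (X := x)
    (a := -b) (b := b) measurable_from_top.aemeasurable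
    (Eventually.of_forall fun s => abs_le.1 (hx s))).mgf_le 1
  rw [ProbabilityTheory.mgf, hP, hP] at h
  -- The interval [-b, b] has half-length b, so the variance proxy is b².
  have e : ((‖b - -b‖₊ / 2) ^ 2 : NNReal) * (1 : ℝ) ^ 2 / 2 = b ^ 2 / 2 := by
    have : (‖b - -b‖ / 2) ^ 2 = b ^ 2 := by
      rw [Real.norm_eq_abs, div_pow, sq_abs]; ring
    push_cast
    rw [this]; ring
  rw [e] at h
  rw [Real.exp_add]
  calc ∑ s, m s * Real.exp (x s)
      = Real.exp (∑ s, m s * x s) *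
          ∑ s, m s * Real.exp (1 * (x s - ∑ s, m s * x s)) := by
        rw [Finset.mul_sum]
        refine Finset.sum_congr rfl fun s _ => ?_
        rw [one_mul, mul_left_comm, ← Real.exp_add]
        congr 2
        ring
    _ ≤ _ := mul_le_mul_of_nonneg_left h (Real.exp_pos _).le

/-- `LSE σ` is `σ`-smooth for the maximum norm. -/
lemma LSE_le_quadratic [Nonempty S] {σ : ℝ} (hσ : 0 < σ) (V W : S → ℝ) {b : ℝ}
    (hb : ∀ s, |W s - V s| ≤ b) :
    LSE σ W - LSE σ V ≤ ∑ s, softmax σ V s * (W s - V s) + σ / 2 * b ^ 2 := by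
  have hm := softmax_mem σ V
  have h := sum_mul_exp_le hm (x := fun s => σ * (W s - V s)) (b := σ * b) fun s => by
    rw [abs_mul, abs_of_pos hσ]
    exact mul_le_mul_of_nonneg_left (hb s) hσ.le
  have e : ∑ s, softmax σ V s * (σ * (W s - V s)) = σ * ∑ s, softmax σ V s * (W s - V s) := by
    rw [Finset.mul_sum]
    exact Finset.sum_congr rfl fun s _ => by ring
  have hpos : 0 < ∑ s, softmax σ V s * Real.exp (σ * (W s - V s)) :=
    (Real.exp_pos _).trans_le <| convexOn_exp.map_sum_le (t := Finset.univ) (w := softmax σ V)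
      (p := fun s => σ * (W s - V s)) (fun s _ => hm.1 s) hm.2 (fun _ _ => Set.mem_univ _)
  rw [LSE_sub_LSE, div_le_iff₀ hσ, Real.log_le_iff_le_exp hpos]
  refine h.trans (le_of_eq ?_)
  rw [e]
  ring_nf

lemma contDiff_LSE [Nonempty S] (σ : ℝ) : ContDiff ℝ 1 (LSE σ : (S → ℝ) → ℝ) := by
  unfold LSE
  refine ContDiff.div_const (ContDiff.log ?_ fun V : S → ℝ => (sum_exp_pos fun s => σ * V s).ne') σ
  fun_prop

/-! ### The nominal kernel and its resolvent -/

/-- The array `π` is a stationary policy. -/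
def IsPolicy [Fintype A] (π : S → A → ℝ) : Prop := ∀ s, π s ∈ stdSimplex ℝ A

lemma IsPolicy.sum_abs {S A : Type*} [Fintype A] {π : S → A → ℝ} (hπ : IsPolicy π) (s : S) : ∑ a, |π s a| = 1 := by
  rw [← (hπ s).2]
  exact Finset.sum_congr rfl fun a _ => abs_of_nonneg ((hπ s).1 a)

lemma sum_mul_le_of_mem_stdSimplex {ι : Type*} [Fintype ι] {w : ι → ℝ} (hw : w ∈ stdSimplex ℝ ι)
    {f : ι → ℝ} {b : ℝ} (hf : ∀ i, f i ≤ b) : ∑ i, w i * f i ≤ b :=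
  calc ∑ i, w i * f i ≤ ∑ i, w i * b :=
        Finset.sum_le_sum fun i _ => mul_le_mul_of_nonneg_left (hf i) (hw.1 i)
    _ = b := by rw [← Finset.sum_mul, hw.2, one_mul]

lemma sum_mul_const_of_mem_stdSimplex {ι : Type*} [Fintype ι] {w : ι → ℝ}
    (hw : w ∈ stdSimplex ℝ ι) (b : ℝ) : ∑ i, w i * b = b := by
  rw [← Finset.sum_mul, hw.2, one_mul]

namespace RobustMDP

variable (M : RobustMDP S A)

/-- The part `γ(1-R)` of the discount factor that belongs to the centre kernel. -/
def β : ℝ := M.γ * (1 - M.R)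

lemma β_nonneg : 0 ≤ M.β := mul_nonneg M.γ_nonneg (sub_nonneg.2 M.R_le_one)

lemma one_sub_β : 1 - M.β = 1 - M.γ + M.γ * M.R := by rw [β]; ring

lemma one_sub_γ_pos : 0 < 1 - M.γ := sub_pos.2 M.γ_lt_one

lemma γR_nonneg : 0 ≤ M.γ * M.R := mul_nonneg M.γ_nonneg M.R_nonneg

lemma one_sub_γ_le : 1 - M.γ ≤ 1 - M.β := by
  rw [one_sub_β]; linarith [M.γR_nonneg]

lemma one_sub_β_pos : 0 < 1 - M.β := M.one_sub_γ_pos.trans_le M.one_sub_γ_le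

/-- The weight of the worst case in the robust value function. -/
def worstWeight : ℝ := M.γ * M.R / (1 - M.γ)

lemma worstWeight_nonneg : 0 ≤ M.worstWeight := div_nonneg M.γR_nonneg M.one_sub_γ_pos.le

/-- Since β + γR = γ, the weight w = γR/(1-γ) solves βw + γR(1 + w) = w. This is the fixed-point
equation of the constant shift, with x either the maximum or the log-sum-exp of the nominal value.
-/
lemma worstWeight_eq (x : ℝ) :
    M.β * (M.worstWeight * x) + M.γ * M.R * (x + M.worstWeight * x) = M.worstWeight * x := by
  have := M.one_sub_γ_pos.ne'
  rw [worstWeight, β]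
  field_simp
  ring

lemma mem_stdSimplex_of_mem_uncertaintySet {M : RobustMDP S A} {P : S → A → S → ℝ} (hP : P ∈ M.uncertaintySet)
    (s : S) (a : A) : P s a ∈ stdSimplex ℝ S := by
  obtain ⟨q, hq, h⟩ := hP s a
  rw [h]
  exact convex_stdSimplex ℝ S (M.p_mem s a) hq (sub_nonneg.2 M.R_le_one) M.R_nonneg (by ring)

variable [Fintype A]

/-- Averaging over actions with the weights `π` and over successor states with the centre
kernel. -/
def nominalOp (π : S → A → ℝ) : (S → ℝ) →ₗ[ℝ] (S → ℝ) where
  toFun f s := ∑ a, π s a * ∑ s', M.p s a s' * f s'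
  map_add' f g := by
    ext s
    simp [mul_add, Finset.sum_add_distrib]
  map_smul' r f := by
    ext s
    simp only [Pi.smul_apply, smul_eq_mul, RingHom.id_apply, Finset.mul_sum]
    exact Finset.sum_congr rfl fun a _ => Finset.sum_congr rfl fun s' _ => by ring

lemma nominalOp_apply (π : S → A → ℝ) (f : S → ℝ) (s : S) :
    M.nominalOp π f s = ∑ a, π s a * ∑ s', M.p s a s' * f s' := rfl

/-- The nominal action values for the continuation values `V`. -/
def qValue (V : S → ℝ) (s : S) (a : A) : ℝ := M.c s a + M.β * ∑ s', M.p s a s' * V s'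

variable {M} {π : S → A → ℝ}

lemma nominalOp_le (hπ : IsPolicy π) {f : S → ℝ} {b : ℝ} (hf : ∀ s, f s ≤ b) (s : S) :
    M.nominalOp π f s ≤ b :=
  sum_mul_le_of_mem_stdSimplex (hπ s) fun a => sum_mul_le_of_mem_stdSimplex (M.p_mem s a) hf

/-- A discrete maximum principle. -/
lemma le_of_le_add_nominalOp (hπ : IsPolicy π) {f x : S → ℝ} {b : ℝ} (hf : ∀ s, f s ≤ b)
    (hx : ∀ s, x s ≤ f s + M.β * M.nominalOp π x s) (s : S) : x s ≤ b / (1 - M.β) := by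
  have : Nonempty S := ⟨s⟩
  obtain ⟨s₀, hs₀⟩ := Finite.exists_max x
  have h1 := hx s₀
  have h2 := mul_le_mul_of_nonneg_left (nominalOp_le (M := M) hπ hs₀ s₀) M.β_nonneg
  have h3 := hf s₀
  rw [le_div_iff₀ M.one_sub_β_pos]
  have := mul_le_mul_of_nonneg_right (hs₀ s) M.one_sub_β_pos.le
  nlinarith

variable (M π) in
/-- The resolvent `(1 - γ(1-R) P_π)⁻¹` of the nominal chain. -/
def resolvent : (S → ℝ) →ₗ[ℝ] (S → ℝ) := Ring.inverse (1 - M.β • M.nominalOp π)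

/-- In finite dimension injectivity is enough, and the maximum principle applied to x and -x shows
that the kernel is trivial. -/
lemma isUnit_one_sub (hπ : IsPolicy π) :
    IsUnit (1 - M.β • M.nominalOp π : Module.End ℝ (S → ℝ)) := by
  rw [LinearMap.isUnit_iff_ker_eq_bot, LinearMap.ker_eq_bot']
  have key : ∀ x : S → ℝ, (1 - M.β • M.nominalOp π : Module.End ℝ (S → ℝ)) x = 0 →
      ∀ s, x s ≤ 0 := fun x hx s => by
    have h := le_of_le_add_nominalOp (M := M) hπ (f := 0) (x := x) (b := 0) (fun _ => le_rfl)
      (fun s => by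
        have := congrFun hx s
        simp only [LinearMap.sub_apply, Module.End.one_apply, LinearMap.smul_apply, Pi.sub_apply,
          Pi.smul_apply, smul_eq_mul, Pi.zero_apply] at this ⊢
        linarith) s
    simpa using h
  intro x hx
  ext s
  refine le_antisymm (key x hx s) ?_
  have := key (-x) (by rw [map_neg, hx, neg_zero]) s
  simpa using this

lemma resolvent_apply (hπ : IsPolicy π) (f : S → ℝ) (s : S) :
    M.resolvent π f s = f s + M.β * M.nominalOp π (M.resolvent π f) s := by
  have h := congrFun (LinearMap.congr_fun (Ring.mul_inverse_cancel _ (isUnit_one_sub (M := M) hπ)) f) s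
  simp only [Module.End.mul_apply, LinearMap.sub_apply, Module.End.one_apply,
    LinearMap.smul_apply, Pi.sub_apply, Pi.smul_apply, smul_eq_mul] at h
  rw [resolvent]
  linarith

lemma eq_resolvent (hπ : IsPolicy π) {f x : S → ℝ}
    (hx : ∀ s, x s = f s + M.β * M.nominalOp π x s) : x = M.resolvent π f := by
  have h := LinearMap.congr_fun (Ring.inverse_mul_cancel _ (isUnit_one_sub (M := M) hπ)) x
  rw [Module.End.mul_apply, Module.End.one_apply] at h
  rw [← h, resolvent]
  congr 1
  ext s
  simp only [LinearMap.sub_apply, Module.End.one_apply,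
    LinearMap.smul_apply, Pi.sub_apply, Pi.smul_apply, smul_eq_mul]
  linarith [hx s]

lemma resolvent_le (hπ : IsPolicy π) {f : S → ℝ} {b : ℝ} (hf : ∀ s, f s ≤ b) (s : S) :
    M.resolvent π f s ≤ b / (1 - M.β) :=
  le_of_le_add_nominalOp hπ hf (fun s => (resolvent_apply hπ f s).le) s

lemma resolvent_nonneg (hπ : IsPolicy π) {f : S → ℝ} (hf : ∀ s, 0 ≤ f s) (s : S) :
    0 ≤ M.resolvent π f s := by
  have := resolvent_le (M := M) hπ (f := -f) (b := 0) (fun s => by simpa using hf s) s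
  simpa using this

/-- All terms of the Neumann series are nonnegative here, and f is the first one. -/
lemma le_resolvent (hπ : IsPolicy π) {f : S → ℝ} (hf : ∀ s, 0 ≤ f s) (s : S) :
    f s ≤ M.resolvent π f s := by
  rw [resolvent_apply hπ]
  have : 0 ≤ M.nominalOp π (M.resolvent π f) s :=
    Finset.sum_nonneg fun a _ => mul_nonneg ((hπ s).1 a) <|
      Finset.sum_nonneg fun s' _ => mul_nonneg ((M.p_mem s a).1 s') (resolvent_nonneg hπ hf s')
  linarith [mul_nonneg M.β_nonneg this]

lemma abs_resolvent_le (hπ : IsPolicy π) {f : S → ℝ} {b : ℝ} (hf : ∀ s, |f s| ≤ b) (s : S) :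
    |M.resolvent π f s| ≤ b / (1 - M.β) := by
  have h1 := resolvent_le (M := M) hπ (fun s => (abs_le.1 (hf s)).2) s
  have h2 := resolvent_le (M := M) hπ (f := -f) (b := b)
    (fun s => by have := (abs_le.1 (hf s)).1; simp only [Pi.neg_apply]; linarith) s
  rw [map_neg, Pi.neg_apply] at h2
  exact abs_le.2 ⟨by linarith, h1⟩

/-! ### The nominal value function -/

variable (M π) in
/-- The value function of `π` for the centre kernel and the discount factor `γ(1-R)`. -/
def nominalValue : S → ℝ := M.resolvent π fun s => ∑ a, π s a * M.c s a

lemma nominalValue_eq (hπ : IsPolicy π) (s : S) :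
    M.nominalValue π s = ∑ a, π s a * M.qValue (M.nominalValue π) s a := by
  rw [nominalValue, resolvent_apply hπ]
  simp only [qValue, mul_add, Finset.sum_add_distrib, nominalOp_apply, Finset.mul_sum]
  congr 1
  exact Finset.sum_congr rfl fun a _ => Finset.sum_congr rfl fun s' _ => by ring

lemma nominalValue_nonneg (hπ : IsPolicy π) (s : S) : 0 ≤ M.nominalValue π s :=
  resolvent_nonneg hπ
    (fun s => Finset.sum_nonneg fun a _ => mul_nonneg ((hπ s).1 a) (M.c_mem s a).1) s

lemma nominalValue_le (hπ : IsPolicy π) (s : S) : M.nominalValue π s ≤ 1 / (1 - M.β) :=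
  resolvent_le hπ (fun s => sum_mul_le_of_mem_stdSimplex (hπ s) fun a => (M.c_mem s a).2) s

lemma qValue_nonneg (hπ : IsPolicy π) (s : S) (a : A) : 0 ≤ M.qValue (M.nominalValue π) s a :=
  add_nonneg (M.c_mem s a).1 <| mul_nonneg M.β_nonneg <| Finset.sum_nonneg fun s' _ =>
    mul_nonneg ((M.p_mem s a).1 s') (nominalValue_nonneg hπ s')

lemma qValue_le (hπ : IsPolicy π) (s : S) (a : A) :
    M.qValue (M.nominalValue π) s a ≤ 1 / (1 - M.β) := by
  have h := mul_le_mul_of_nonneg_left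
    (sum_mul_le_of_mem_stdSimplex (M.p_mem s a) (nominalValue_le (M := M) hπ)) M.β_nonneg
  have hβ := M.one_sub_β_pos
  have e : 1 + M.β * (1 / (1 - M.β)) = 1 / (1 - M.β) := by field_simp; ring
  rw [qValue, ← e]
  exact add_le_add (M.c_mem s a).2 h

/-- The performance difference formula. -/
lemma nominalValue_sub (hπ : IsPolicy π) {π' : S → A → ℝ} (hπ' : IsPolicy π') :
    M.nominalValue π' - M.nominalValue π =
      M.resolvent π' fun s => ∑ a, (π' s a - π s a) * M.qValue (M.nominalValue π) s a := by
  refine eq_resolvent hπ' fun s => ?_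
  rw [Pi.sub_apply, nominalValue_eq hπ, nominalValue_eq hπ', map_sub, Pi.sub_apply,
    nominalOp_apply, nominalOp_apply, mul_sub, Finset.mul_sum, Finset.mul_sum,
    ← Finset.sum_sub_distrib, ← Finset.sum_sub_distrib, ← Finset.sum_add_distrib]
  refine Finset.sum_congr rfl fun a _ => ?_
  simp only [qValue]
  ring

end RobustMDP

end

section

variable {S A : Type*} [Fintype S] [Fintype A]

namespace RobustMDP

variable {M : RobustMDP S A} {π : S → A → ℝ}

/-! ### The robust value function in closed form -/

/-- A Bellman backup turns a shift by b into a shift by βb. This one computation verifies the closed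
forms of both the robust and the smoothed value. -/
lemma nominalValue_add_const (hπ : IsPolicy π) (b d : ℝ) (s : S) :
    ∑ a, π s a * (M.c s a + M.β * ∑ s', M.p s a s' * (M.nominalValue π s' + b) + d) =
      M.nominalValue π s + (M.β * b + d) := by
  conv_rhs => rw [nominalValue_eq hπ, ← sum_mul_const_of_mem_stdSimplex (hπ s) (M.β * b + d),
    ← Finset.sum_add_distrib]
  refine Finset.sum_congr rfl fun a _ => ?_
  have : ∑ s', M.p s a s' * (M.nominalValue π s' + b) =
      ∑ s', M.p s a s' * M.nominalValue π s' + b := by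
    simp only [mul_add, Finset.sum_add_distrib]
    rw [sum_mul_const_of_mem_stdSimplex (M.p_mem s a)]
  rw [this, qValue]
  ring

lemma stateDist_mem (hπ : IsPolicy π) {κ : ℕ → S → A → S → ℝ}
    (hκ : ∀ t s a, κ t s a ∈ stdSimplex ℝ S) (s : S) (t : ℕ) :
    stateDist π κ s t ∈ stdSimplex ℝ S := by
  classical
  induction t with
  | zero =>
    rw [stateDist]
    convert! single_mem_stdSimplex ℝ s
  | succ t ih =>
    refine ⟨fun s' => Finset.sum_nonneg fun x _ => Finset.sum_nonneg fun a _ =>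
      mul_nonneg (mul_nonneg (ih.1 x) ((hπ x).1 a)) ((hκ t x a).1 s'), ?_⟩
    simp only [stateDist]
    rw [Finset.sum_comm]
    rw [← ih.2]
    refine Finset.sum_congr rfl fun x _ => ?_
    rw [Finset.sum_comm]
    simp only [← Finset.mul_sum, (hκ t x _).2, mul_one, (hπ x).2]

lemma sum_stateDist_succ (κ : ℕ → S → A → S → ℝ) (s : S) (t : ℕ) (V : S → ℝ) :
    ∑ s', stateDist π κ s (t + 1) s' * V s' =
      ∑ x, ∑ a, stateDist π κ s t x * π x a * ∑ s', κ t x a s' * V s' := by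
  simp only [stateDist, Finset.sum_mul, Finset.mul_sum]
  rw [Finset.sum_comm]
  refine Finset.sum_congr rfl fun x _ => ?_
  rw [Finset.sum_comm]
  exact Finset.sum_congr rfl fun a _ => Finset.sum_congr rfl fun s' _ => by ring

lemma sum_stateDist_zero (κ : ℕ → S → A → S → ℝ) (s : S) (V : S → ℝ) :
    ∑ s', stateDist π κ s 0 s' * V s' = V s := by
  classical
  simp only [stateDist]
  rw [Finset.sum_eq_single s (fun x _ hx => by simp [hx]) (by simp)]
  simp

/-- Telescoping of the expected value of `V` along the controlled chain. -/
lemma sum_range_discounted {κ : ℕ → S → A → S → ℝ} (V : S → ℝ) (s : S) (N : ℕ) :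
    ∑ t ∈ Finset.range N, M.γ ^ t * ∑ x, stateDist π κ s t x *
      (V x - ∑ a, π x a * (M.γ * ∑ s', κ t x a s' * V s')) =
      V s - M.γ ^ N * ∑ s', stateDist π κ s N s' * V s' := by
  induction N with
  | zero => simp [sum_stateDist_zero]
  | succ N ih =>
    rw [Finset.sum_range_succ, ih, sum_stateDist_succ, pow_succ]
    simp only [mul_sub, Finset.sum_sub_distrib, Finset.mul_sum]
    have : ∑ x, ∑ a, ∑ s', M.γ ^ N * (stateDist π κ s N x * (π x a * (M.γ * (κ N x a s' * V s'))))
        = ∑ x, ∑ a, ∑ s', M.γ ^ N * M.γ * (stateDist π κ s N x * π x a * (κ N x a s' * V s')) :=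
      Finset.sum_congr rfl fun x _ => Finset.sum_congr rfl fun a _ =>
        Finset.sum_congr rfl fun s' _ => by ring
    rw [this]
    ring

lemma hasSum_discountedCost (hπ : IsPolicy π) {κ : ℕ → S → A → S → ℝ}
    (hκ : ∀ t, κ t ∈ M.uncertaintySet) (s : S) :
    HasSum (fun t : ℕ => M.γ ^ t * ∑ x, ∑ a, stateDist π κ s t x * π x a * M.c x a)
      (M.discountedCost π κ s) := by
  refine Summable.hasSum ?_
  have hd := stateDist_mem hπ (fun t s a => mem_stdSimplex_of_mem_uncertaintySet (hκ t) s a) s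
  refine Summable.of_nonneg_of_le (fun t => ?_) (fun t => ?_)
    (summable_geometric_of_lt_one M.γ_nonneg M.γ_lt_one)
  · exact mul_nonneg (pow_nonneg M.γ_nonneg t) <| Finset.sum_nonneg fun x _ =>
      Finset.sum_nonneg fun a _ =>
        mul_nonneg (mul_nonneg ((hd t).1 x) ((hπ x).1 a)) (M.c_mem x a).1
  · refine mul_le_of_le_one_right (pow_nonneg M.γ_nonneg t) ?_
    simp only [mul_assoc, ← Finset.mul_sum]
    exact sum_mul_le_of_mem_stdSimplex (hd t) fun x =>
      sum_mul_le_of_mem_stdSimplex (hπ x) fun a => (M.c_mem x a).2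

lemma tendsto_discounted_value (hπ : IsPolicy π) {κ : ℕ → S → A → S → ℝ}
    (hκ : ∀ t, κ t ∈ M.uncertaintySet) (s : S) (V : S → ℝ) :
    Tendsto (fun N : ℕ => V s - M.γ ^ N * ∑ s', stateDist π κ s N s' * V s') atTop (𝓝 (V s)) := by
  have hd := stateDist_mem hπ (fun t s a => mem_stdSimplex_of_mem_uncertaintySet (hκ t) s a) s
  have h0 : Tendsto (fun N : ℕ => M.γ ^ N * ‖V‖) atTop (𝓝 0) := by
    simpa using (tendsto_pow_atTop_nhds_zero_of_lt_one M.γ_nonneg M.γ_lt_one).mul_const ‖V‖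
  have h1 : Tendsto (fun N : ℕ => M.γ ^ N * ∑ s', stateDist π κ s N s' * V s') atTop (𝓝 0) := by
    refine squeeze_zero_norm (fun N => ?_) h0
    rw [norm_mul, norm_pow, Real.norm_of_nonneg M.γ_nonneg]
    refine mul_le_mul_of_nonneg_left ?_ (pow_nonneg M.γ_nonneg N)
    refine (norm_sum_le _ _).trans ?_
    simp only [norm_mul, Real.norm_of_nonneg ((hd N).1 _)]
    exact sum_mul_le_of_mem_stdSimplex (hd N) fun x => norm_le_pi_norm V x
  simpa using tendsto_const_nhds.sub h1

/-- A verification argument: a Bellman supersolution along the chosen kernels dominates the cost,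
because the discounted defects telescope and the tail vanishes. -/
lemma discountedCost_le (hπ : IsPolicy π) {κ : ℕ → S → A → S → ℝ}
    (hκ : ∀ t, κ t ∈ M.uncertaintySet) {V : S → ℝ}
    (hV : ∀ t x, ∑ a, π x a * (M.c x a + M.γ * ∑ s', κ t x a s' * V s') ≤ V x) (s : S) :
    M.discountedCost π κ s ≤ V s := by
  have hd := stateDist_mem hπ (fun t s a => mem_stdSimplex_of_mem_uncertaintySet (hκ t) s a) s
  refine le_of_tendsto_of_tendsto' (hasSum_discountedCost hπ hκ s).tendsto_sum_nat
    (tendsto_discounted_value hπ hκ s V) fun N => ?_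
  rw [← sum_range_discounted]
  refine Finset.sum_le_sum fun t _ => mul_le_mul_of_nonneg_left ?_ (pow_nonneg M.γ_nonneg t)
  simp only [mul_assoc, ← Finset.mul_sum]
  refine Finset.sum_le_sum fun x _ => mul_le_mul_of_nonneg_left ?_ ((hd t).1 x)
  have := hV t x
  simp only [mul_add, Finset.sum_add_distrib] at this
  linarith

lemma discountedCost_eq (hπ : IsPolicy π) {κ : ℕ → S → A → S → ℝ}
    (hκ : ∀ t, κ t ∈ M.uncertaintySet) {V : S → ℝ}
    (hV : ∀ t x, ∑ a, π x a * (M.c x a + M.γ * ∑ s', κ t x a s' * V s') = V x) (s : S) :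
    M.discountedCost π κ s = V s := by
  refine tendsto_nhds_unique (hasSum_discountedCost hπ hκ s).tendsto_sum_nat
    ((tendsto_discounted_value hπ hκ s V).congr fun N => ?_)
  rw [← sum_range_discounted]
  refine Finset.sum_congr rfl fun t _ => ?_
  congr 1
  simp only [mul_assoc, ← Finset.mul_sum]
  refine Finset.sum_congr rfl fun x _ => ?_
  have := hV t x
  simp only [mul_add, Finset.sum_add_distrib] at this
  rw [← this]
  ring

/-- The robust value function is the nominal value function, shifted by a multiple of its
maximum. -/
lemma robustValue_eq (hπ : IsPolicy π) {s₀ : S}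
    (hs₀ : ∀ s, M.nominalValue π s ≤ M.nominalValue π s₀) (s : S) :
    M.robustValue π s = M.nominalValue π s + M.worstWeight * M.nominalValue π s₀ := by
  classical
  set B := M.nominalValue π
  set V : S → ℝ := fun s => B s + M.worstWeight * B s₀ with hVdef
  have hV : ∀ x, ∑ a, π x a * (M.c x a + M.β * ∑ s', M.p x a s' * V s' +
      M.γ * M.R * V s₀) = V x := fun x => by
    rw [nominalValue_add_const hπ, hVdef]
    simp only
    rw [worstWeight_eq]
  have hmix : ∀ {P : S → A → S → ℝ} {q : S → ℝ} {x : S} {a : A},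
      P x a = (1 - M.R) • M.p x a + M.R • q →
      M.γ * ∑ s', P x a s' * V s' = M.β * ∑ s', M.p x a s' * V s' +
        M.γ * M.R * ∑ s', q s' * V s' := fun {P q x a} h => by
    rw [h, β]
    simp only [Pi.add_apply, Pi.smul_apply, smul_eq_mul, Finset.mul_sum]
    rw [← Finset.sum_add_distrib]
    exact Finset.sum_congr rfl fun s' _ => by ring
  have hle : ∀ κ : {κ : ℕ → S → A → S → ℝ // ∀ t, κ t ∈ M.uncertaintySet},
      M.discountedCost π κ.1 s ≤ V s := fun κ => by
    refine discountedCost_le hπ κ.2 (fun t x => ?_) s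
    rw [← hV x]
    refine Finset.sum_le_sum fun a _ => mul_le_mul_of_nonneg_left ?_ ((hπ x).1 a)
    obtain ⟨q, hq, h⟩ := κ.2 t x a
    rw [hmix h, add_assoc]
    gcongr
    · exact M.γR_nonneg
    · exact sum_mul_le_of_mem_stdSimplex hq fun s' => add_le_add_left (hs₀ s') _
  -- The worst case is attained by a stationary adversary that sends all contaminating mass to a
  -- maximizer of the nominal value.
  let P₀ : S → A → S → ℝ := fun x a => (1 - M.R) • M.p x a + M.R • Pi.single s₀ 1
  have hP₀ : ∀ _ : ℕ, P₀ ∈ M.uncertaintySet := fun _ x a =>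
    ⟨Pi.single s₀ 1, single_mem_stdSimplex ℝ s₀, rfl⟩
  have heq : M.discountedCost π (fun _ => P₀) s = V s := by
    refine discountedCost_eq hπ hP₀ (fun _ x => ?_) s
    rw [← hV x]
    refine Finset.sum_congr rfl fun a _ => ?_
    rw [hmix (P := P₀) (x := x) (a := a) rfl, add_assoc]
    simp [Pi.single_apply]
  have : Nonempty {κ : ℕ → S → A → S → ℝ // ∀ t, κ t ∈ M.uncertaintySet} := ⟨⟨_, hP₀⟩⟩
  refine le_antisymm (ciSup_le hle) (heq.ge.trans ?_)
  exact le_ciSup (f := fun κ : {κ : ℕ → S → A → S → ℝ // ∀ t, κ t ∈ M.uncertaintySet} =>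
    M.discountedCost π κ.1 s) ⟨V s, by rintro _ ⟨κ, rfl⟩; exact hle κ⟩ ⟨_, hP₀⟩

/-! ### The smoothed value function in closed form -/

/-- The bound b on the absolute row sums replaces 1 so that the estimate also covers arrays near Θ
that are not policies, as differentiation in the ambient space requires. -/
lemma norm_smoothedBellman_sub_le [Nonempty S] {σ : ℝ} (hσ : 0 < σ) {b : ℝ} (hb : 0 ≤ b)
    (hπ : ∀ s, ∑ a, |π s a| ≤ b) (V W : S → ℝ) :
    ‖M.smoothedBellman σ π V - M.smoothedBellman σ π W‖ ≤ b * M.γ * ‖V - W‖ := by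
  have hn := norm_nonneg (V - W)
  refine (pi_norm_le_iff_of_nonneg (mul_nonneg (mul_nonneg hb M.γ_nonneg) hn)).2 fun s => ?_
  have hterm : ∀ a, |M.γ * (1 - M.R) * ∑ s', M.p s a s' * (V s' - W s') +
      M.γ * M.R * (LSE σ V - LSE σ W)| ≤ M.γ * ‖V - W‖ := fun a => by
    have h1 : |∑ s', M.p s a s' * (V s' - W s')| ≤ ‖V - W‖ := by
      refine (Finset.abs_sum_le_sum_abs _ _).trans ?_
      simp only [abs_mul, abs_of_nonneg ((M.p_mem s a).1 _)]
      exact sum_mul_le_of_mem_stdSimplex (M.p_mem s a) fun s' => norm_le_pi_norm (V - W) s'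
    refine (abs_add_le _ _).trans ?_
    rw [abs_mul, abs_mul (M.γ * M.R), abs_of_nonneg M.γR_nonneg, abs_of_nonneg (mul_nonneg M.γ_nonneg (sub_nonneg.2 M.R_le_one))]
    calc _ ≤ M.γ * (1 - M.R) * ‖V - W‖ + M.γ * M.R * ‖V - W‖ :=
          add_le_add (mul_le_mul_of_nonneg_left h1 (mul_nonneg M.γ_nonneg (sub_nonneg.2 M.R_le_one)))
            (mul_le_mul_of_nonneg_left (abs_LSE_sub_LSE_le hσ V W) M.γR_nonneg)
      _ = _ := by ring
  have e : (M.smoothedBellman σ π V - M.smoothedBellman σ π W) s =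
      ∑ a, π s a * (M.γ * (1 - M.R) * ∑ s', M.p s a s' * (V s' - W s') +
        M.γ * M.R * (LSE σ V - LSE σ W)) := by
    simp only [Pi.sub_apply, smoothedBellman]
    rw [← Finset.sum_sub_distrib]
    refine Finset.sum_congr rfl fun a _ => ?_
    simp only [mul_sub, Finset.sum_sub_distrib]
    ring
  rw [e, Real.norm_eq_abs]
  refine (Finset.abs_sum_le_sum_abs _ _).trans ?_
  simp only [abs_mul (π s _)]
  calc _ ≤ ∑ a, |π s a| * (M.γ * ‖V - W‖) :=
        Finset.sum_le_sum fun a _ => mul_le_mul_of_nonneg_left (hterm a) (abs_nonneg _)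
    _ = (∑ a, |π s a|) * (M.γ * ‖V - W‖) := by rw [Finset.sum_mul]
    _ ≤ b * (M.γ * ‖V - W‖) :=
        mul_le_mul_of_nonneg_right (hπ s) (mul_nonneg M.γ_nonneg hn)
    _ = _ := by ring

/-- Fixed points of the smoothed Bellman operator are unique if `γ ∑_a |π(a|s)| < 1`. -/
lemma smoothedValue_eq_of_isFixedPt [Nonempty S] {σ : ℝ} (hσ : 0 < σ) {b : ℝ} (hb : 0 ≤ b)
    (hbγ : b * M.γ < 1) (hπ : ∀ s, ∑ a, |π s a| ≤ b) {V : S → ℝ}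
    (hV : Function.IsFixedPt (M.smoothedBellman σ π) V) : M.smoothedValue σ π = V := by
  have hW : Function.IsFixedPt (M.smoothedBellman σ π) (M.smoothedValue σ π) :=
    Classical.epsilon_spec (p := fun V => Function.IsFixedPt (M.smoothedBellman σ π) V) ⟨V, hV⟩
  have h := norm_smoothedBellman_sub_le (M := M) hσ hb hπ (M.smoothedValue σ π) V
  rw [hW.eq, hV.eq] at h
  have h0 := norm_nonneg (M.smoothedValue σ π - V)
  rw [← sub_eq_zero, ← norm_eq_zero]
  nlinarith

lemma isFixedPt_smoothedBellman [Nonempty S] {σ : ℝ} (hσ : 0 < σ) (hπ : IsPolicy π) :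
    Function.IsFixedPt (M.smoothedBellman σ π)
      (fun s => M.nominalValue π s + M.worstWeight * LSE σ (M.nominalValue π)) := by
  ext s
  rw [smoothedBellman, LSE_add_const hσ]
  have := nominalValue_add_const (M := M) hπ (M.worstWeight * LSE σ (M.nominalValue π))
    (M.γ * M.R * (LSE σ (M.nominalValue π) + M.worstWeight * LSE σ (M.nominalValue π))) s
  rw [worstWeight_eq] at this
  exact this

/-- The smoothed value function is the nominal value function, shifted by a multiple of its
log-sum-exp. -/
lemma smoothedValue_eq [Nonempty S] {σ : ℝ} (hσ : 0 < σ) (hπ : IsPolicy π) (s : S) :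
    M.smoothedValue σ π s =
      M.nominalValue π s + M.worstWeight * LSE σ (M.nominalValue π) := by
  rw [smoothedValue_eq_of_isFixedPt hσ zero_le_one (by simpa using M.γ_lt_one)
    (fun s => (hπ.sum_abs s).le) (isFixedPt_smoothedBellman hσ hπ)]

lemma robustValue_le_smoothedValue [Nonempty S] {σ : ℝ} (hσ : 0 < σ) (hπ : IsPolicy π) (s : S) :
    M.robustValue π s ≤ M.smoothedValue σ π s := by
  obtain ⟨s₀, hs₀⟩ := Finite.exists_max (M.nominalValue π)
  rw [robustValue_eq hπ hs₀, smoothedValue_eq hσ hπ]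
  gcongr
  · exact M.worstWeight_nonneg
  · exact le_LSE hσ _ s₀

lemma smoothedValue_le_robustValue_add [Nonempty S] {σ : ℝ} (hσ : 0 < σ) (hπ : IsPolicy π)
    (s : S) : M.smoothedValue σ π s ≤
      M.robustValue π s + M.worstWeight * (Real.log (Fintype.card S) / σ) := by
  obtain ⟨s₀, hs₀⟩ := Finite.exists_max (M.nominalValue π)
  rw [robustValue_eq hπ hs₀, smoothedValue_eq hσ hπ, add_assoc, ← mul_add]
  gcongr
  · exact M.worstWeight_nonneg
  · exact LSE_le_of_le hσ hs₀

end RobustMDP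

end

section

variable {S A : Type*} [Fintype S] [Fintype A]

namespace RobustMDP

variable {M : RobustMDP S A} {π π' : S → A → ℝ}

/-! ### First-order expansion of the smoothed objective -/

variable (M) in
/-- The weights with which the nominal value function enters the derivative of the smoothed
objective. -/
def slopeWeight (ρ : S → ℝ) (σ : ℝ) (π : S → A → ℝ) (s : S) : ℝ :=
  ρ s + M.worstWeight * softmax σ (M.nominalValue π) s

variable (M) in
/-- The derivative of the smoothed objective at the policy `π` in a direction `u` tangent to the
set of policies. -/
def slope (ρ : S → ℝ) (σ : ℝ) (π u : S → A → ℝ) : ℝ :=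
  ∑ s, M.slopeWeight ρ σ π s *
    M.resolvent π (fun s => ∑ a, u s a * M.qValue (M.nominalValue π) s a) s

lemma slope_smul (ρ : S → ℝ) (σ : ℝ) (π u : S → A → ℝ) (r : ℝ) :
    M.slope ρ σ π (fun s a => r * u s a) = r * M.slope ρ σ π u := by
  have : (fun s => ∑ a, r * u s a * M.qValue (M.nominalValue π) s a) =
      r • fun s => ∑ a, u s a * M.qValue (M.nominalValue π) s a := by
    ext s
    simp only [Pi.smul_apply, smul_eq_mul, Finset.mul_sum, mul_assoc]
  rw [slope, slope, this, map_smul, Finset.mul_sum]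
  exact Finset.sum_congr rfl fun s _ => by rw [Pi.smul_apply, smul_eq_mul]; ring

lemma sum_slopeWeight_mul_sub (ρ : S → ℝ) (σ : ℝ) :
    ∑ s, M.slopeWeight ρ σ π s * (M.nominalValue π' s - M.nominalValue π s) =
      ∑ s, ρ s * M.nominalValue π' s - ∑ s, ρ s * M.nominalValue π s + M.worstWeight *
        ∑ s, softmax σ (M.nominalValue π) s * (M.nominalValue π' s - M.nominalValue π s) := by
  rw [Finset.mul_sum, ← Finset.sum_sub_distrib, ← Finset.sum_add_distrib]
  exact Finset.sum_congr rfl fun s _ => by rw [slopeWeight]; ring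

lemma abs_sum_mul_qValue_le (hπ : IsPolicy π) {u : S → A → ℝ} {d : ℝ}
    (hd : ∀ s, ∑ a, |u s a| ≤ d) (s : S) :
    |∑ a, u s a * M.qValue (M.nominalValue π) s a| ≤ d * (1 / (1 - M.β)) := by
  have hδ := M.one_sub_β_pos
  refine (Finset.abs_sum_le_sum_abs _ _).trans ?_
  calc _ ≤ ∑ a, |u s a| * (1 / (1 - M.β)) := Finset.sum_le_sum fun a _ => by
        rw [abs_mul, abs_of_nonneg (qValue_nonneg hπ s a)]
        exact mul_le_mul_of_nonneg_left (qValue_le hπ s a) (abs_nonneg _)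
    _ ≤ _ := by
        rw [← Finset.sum_mul]
        exact mul_le_mul_of_nonneg_right (hd s) (by positivity)

/-- In the performance difference formula the action values and the resolvent each contribute a
factor 1/(1-β). -/
lemma abs_nominalValue_sub_le (hπ : IsPolicy π) (hπ' : IsPolicy π') {d : ℝ}
    (hd : ∀ s, ∑ a, |π' s a - π s a| ≤ d) (s : S) :
    |M.nominalValue π' s - M.nominalValue π s| ≤ d / (1 - M.β) ^ 2 := by
  have h := abs_resolvent_le (M := M) hπ'
    (abs_sum_mul_qValue_le (M := M) (u := fun s a => π' s a - π s a) hπ hd) s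
  rw [← nominalValue_sub hπ hπ', Pi.sub_apply] at h
  refine h.trans (le_of_eq ?_)
  have := M.one_sub_β_pos.ne'
  field_simp

/-- The second-order remainder of the nominal value function. -/
lemma abs_nominalValue_remainder_le (hπ : IsPolicy π) (hπ' : IsPolicy π') {d : ℝ}
    (hd : ∀ s, ∑ a, |π' s a - π s a| ≤ d) (s : S) :
    |M.nominalValue π' s - M.nominalValue π s - M.resolvent π
        (fun s => ∑ a, (π' s a - π s a) * M.qValue (M.nominalValue π) s a) s| ≤
      M.β * d ^ 2 / (1 - M.β) ^ 3 := by
  have hδ := M.one_sub_β_pos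
  set x := M.nominalValue π' - M.nominalValue π with hx
  set r : S → ℝ := fun s => ∑ a, (π' s a - π s a) * M.qValue (M.nominalValue π) s a
  have hxb : ∀ s, |x s| ≤ d / (1 - M.β) ^ 2 := abs_nominalValue_sub_le hπ hπ' hd
  have hd0 : 0 ≤ d := (Finset.sum_nonneg fun _ _ => abs_nonneg _).trans (hd s)
  -- The increment x solves a Bellman equation for π'. Rewritten for π, its source gains the term
  -- β(P_π' - P_π)x, which is of second order because both factors are O(d).
  have h1 : x = M.resolvent π (r + M.β • (M.nominalOp π' x - M.nominalOp π x)) := by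
    refine eq_resolvent hπ fun s => ?_
    have := resolvent_apply (M := M) hπ' r s
    rw [← nominalValue_sub hπ hπ', ← hx] at this
    simp only [Pi.add_apply, Pi.smul_apply, Pi.sub_apply, smul_eq_mul]
    linarith
  have h2 : ∀ s, |(M.β • (M.nominalOp π' x - M.nominalOp π x)) s| ≤
      M.β * (d * (d / (1 - M.β) ^ 2)) := fun s => by
    simp only [Pi.smul_apply, Pi.sub_apply, smul_eq_mul]
    rw [abs_mul, abs_of_nonneg M.β_nonneg, nominalOp_apply, nominalOp_apply,
      ← Finset.sum_sub_distrib]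
    refine mul_le_mul_of_nonneg_left ?_ M.β_nonneg
    refine (Finset.abs_sum_le_sum_abs _ _).trans ?_
    calc _ ≤ ∑ a, |π' s a - π s a| * (d / (1 - M.β) ^ 2) := Finset.sum_le_sum fun a _ => by
          rw [← sub_mul, abs_mul]
          refine mul_le_mul_of_nonneg_left ?_ (abs_nonneg _)
          refine (Finset.abs_sum_le_sum_abs _ _).trans ?_
          simp only [abs_mul, abs_of_nonneg ((M.p_mem s a).1 _)]
          exact sum_mul_le_of_mem_stdSimplex (M.p_mem s a) hxb
      _ ≤ _ := by
          rw [← Finset.sum_mul]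
          exact mul_le_mul_of_nonneg_right (hd s) (by positivity)
  have h3 := abs_resolvent_le (M := M) hπ h2 s
  have h4 := congrFun h1 s
  rw [map_add, Pi.add_apply] at h4
  have h5 : M.nominalValue π' s - M.nominalValue π s = x s := rfl
  rw [h5, h4, add_sub_cancel_left]
  refine h3.trans (le_of_eq ?_)
  field_simp

section

variable [Nonempty S] {ρ : S → ℝ}

lemma le_slopeWeight (σ : ℝ) (s : S) : ρ s ≤ M.slopeWeight ρ σ π s :=
  le_add_of_nonneg_right (mul_nonneg M.worstWeight_nonneg ((softmax_mem _ _).1 s))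

lemma slopeWeight_nonneg (hρ : ρ ∈ stdSimplex ℝ S) (σ : ℝ) (s : S) :
    0 ≤ M.slopeWeight ρ σ π s := (hρ.1 s).trans (le_slopeWeight σ s)

lemma sum_slopeWeight (hρ : ρ ∈ stdSimplex ℝ S) (σ : ℝ) :
    ∑ s, M.slopeWeight ρ σ π s = 1 + M.worstWeight := by
  simp only [slopeWeight, Finset.sum_add_distrib, ← Finset.mul_sum]
  rw [hρ.2, (softmax_mem _ _).2, mul_one]

variable (M) in
/-- The smoothed objective in closed form. -/
def smoothedObjective (ρ : S → ℝ) (σ : ℝ) (π : S → A → ℝ) : ℝ :=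
  ∑ s, ρ s * M.nominalValue π s + M.worstWeight * LSE σ (M.nominalValue π)

lemma sum_smoothedValue (hρ : ρ ∈ stdSimplex ℝ S) {σ : ℝ} (hσ : 0 < σ) (hπ : IsPolicy π) :
    ∑ s, ρ s * M.smoothedValue σ π s = M.smoothedObjective ρ σ π := by
  simp only [smoothedValue_eq hσ hπ, mul_add, Finset.sum_add_distrib]
  rw [sum_mul_const_of_mem_stdSimplex hρ, smoothedObjective]

/-- The smoothed objective is a convex function of the nominal value function. -/
lemma slopeWeight_le_smoothedObjective_sub {σ : ℝ} (hσ : 0 < σ) :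
    ∑ s, M.slopeWeight ρ σ π s * (M.nominalValue π' s - M.nominalValue π s) ≤
      M.smoothedObjective ρ σ π' - M.smoothedObjective ρ σ π := by
  have h := mul_le_mul_of_nonneg_left
    (LSE_ge_linear hσ (M.nominalValue π) (M.nominalValue π')) M.worstWeight_nonneg
  rw [sum_slopeWeight_mul_sub, smoothedObjective, smoothedObjective]
  linarith

/-- Convexity of LSE gives the lower bound and its smoothness the upper one. Replacing the true
increment of the nominal value by its linear part adds the nominal remainder, weighted by the total
mass 1 + w of the slope weights. -/
lemma abs_smoothedObjective_remainder_le (hρ : ρ ∈ stdSimplex ℝ S) {σ : ℝ} (hσ : 0 < σ)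
    (hπ : IsPolicy π) (hπ' : IsPolicy π') {d : ℝ} (hd : ∀ s, ∑ a, |π' s a - π s a| ≤ d) :
    |M.smoothedObjective ρ σ π' - M.smoothedObjective ρ σ π -
        M.slope ρ σ π (fun s a => π' s a - π s a)| ≤
      ((1 + M.worstWeight) * (M.β / (1 - M.β) ^ 3) +
        M.worstWeight * (σ / (2 * (1 - M.β) ^ 4))) * d ^ 2 := by
  have hδ := M.one_sub_β_pos
  have hW := M.worstWeight_nonneg
  have h1 := slopeWeight_le_smoothedObjective_sub (M := M) (ρ := ρ) (π := π) (π' := π') hσ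
  have h2 := mul_le_mul_of_nonneg_left (LSE_le_quadratic hσ (M.nominalValue π)
    (M.nominalValue π') (abs_nominalValue_sub_le hπ hπ' hd)) hW
  have h3 : |∑ s, M.slopeWeight ρ σ π s * (M.nominalValue π' s - M.nominalValue π s) -
      M.slope ρ σ π (fun s a => π' s a - π s a)| ≤
      (1 + M.worstWeight) * (M.β * d ^ 2 / (1 - M.β) ^ 3) := by
    rw [slope, ← Finset.sum_sub_distrib, ← sum_slopeWeight (M := M) (π := π) hρ σ, Finset.sum_mul]
    refine (Finset.abs_sum_le_sum_abs _ _).trans (Finset.sum_le_sum fun s _ => ?_)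
    rw [← mul_sub, abs_mul, abs_of_nonneg (slopeWeight_nonneg hρ σ s)]
    exact mul_le_mul_of_nonneg_left (abs_nominalValue_remainder_le hπ hπ' hd s)
      (slopeWeight_nonneg hρ σ s)
  rw [sum_slopeWeight_mul_sub] at h1 h3
  have e : ((1 + M.worstWeight) * (M.β / (1 - M.β) ^ 3) +
      M.worstWeight * (σ / (2 * (1 - M.β) ^ 4))) * d ^ 2 =
      (1 + M.worstWeight) * (M.β * d ^ 2 / (1 - M.β) ^ 3) +
        M.worstWeight * (σ / 2 * (d / (1 - M.β) ^ 2) ^ 2) := by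
    field_simp
  have h4 : 0 ≤ M.worstWeight * (σ / 2 * (d / (1 - M.β) ^ 2) ^ 2) := by positivity
  rw [e]
  rw [abs_le] at h3 ⊢
  simp only [smoothedObjective] at h1 ⊢
  constructor <;> linarith [h3.1, h3.2]

/-! ### Gradient dominance -/

/-- The witness is greedy for the action values of π, hence independent of the competitor π'. Its
statewise gain f is nonnegative and bounds the gain of every other policy. -/
lemma smoothedObjective_sub_le_slope [Nonempty A] (hρ : ρ ∈ stdSimplex ℝ S)
    (hρ_pos : ∀ s, 0 < ρ s) {σ : ℝ} (hσ : 0 < σ) (hπ : IsPolicy π) :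
    ∃ ψ : S → A → ℝ, IsPolicy ψ ∧ ∀ π' : S → A → ℝ, IsPolicy π' →
      M.smoothedObjective ρ σ π - M.smoothedObjective ρ σ π' ≤
        M.CPL ρ * M.slope ρ σ π (fun s a => π s a - ψ s a) := by
  classical
  set Q := M.qValue (M.nominalValue π) with hQ
  choose g hg using fun s => Finite.exists_min (Q s)
  refine ⟨fun s => Pi.single (g s) 1, fun s => single_mem_stdSimplex ℝ (g s), fun π' hπ' => ?_⟩
  have hδ := M.one_sub_β_pos
  have hγ := M.one_sub_γ_pos
  set f : S → ℝ := fun s => ∑ a, (π s a - (Pi.single (g s) 1 : A → ℝ) a) * Q s a with hf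
  have hfs : ∀ s, f s = ∑ a, π s a * Q s a - Q s (g s) := fun s => by
    simp [hf, sub_mul, Finset.sum_sub_distrib, Pi.single_apply]
  have hmin : ∀ {π'' : S → A → ℝ}, IsPolicy π'' → ∀ s, Q s (g s) ≤ ∑ a, π'' s a * Q s a :=
    fun {π''} h s => by
      have := sum_mul_le_of_mem_stdSimplex (h s) (f := fun a => -Q s a) (b := -Q s (g s))
        fun a => neg_le_neg (hg s a)
      simp only [mul_neg, Finset.sum_neg_distrib] at this
      linarith
  have hf0 : ∀ s, 0 ≤ f s := fun s => by rw [hfs]; exact sub_nonneg.2 (hmin hπ s)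
  have hν := slopeWeight_nonneg (M := M) (π := π) hρ σ
  have hinf : 0 < ⨅ s, ρ s := by
    obtain ⟨s, hs⟩ := exists_eq_ciInf_of_finite (f := ρ)
    rw [← hs]
    exact hρ_pos s
  -- Full support of ρ turns the ρ-average of f into a uniform bound; this is where 1/ρ_min enters.
  have hb : ∀ s, f s ≤ (∑ s, ρ s * f s) / ⨅ s, ρ s := fun s => by
    rw [le_div_iff₀ hinf, mul_comm]
    refine (mul_le_mul_of_nonneg_right (ciInf_le (Set.finite_range ρ).bddBelow s) (hf0 s)).trans ?_
    exact Finset.single_le_sum (f := fun s => ρ s * f s)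
      (fun s _ => mul_nonneg (hρ.1 s) (hf0 s)) (Finset.mem_univ s)
  have h1 : M.smoothedObjective ρ σ π - M.smoothedObjective ρ σ π' ≤
      ∑ s, M.slopeWeight ρ σ π s * (M.nominalValue π s - M.nominalValue π' s) := by
    have := slopeWeight_le_smoothedObjective_sub (M := M) (ρ := ρ) (π := π) (π' := π') hσ
    have e : ∑ s, M.slopeWeight ρ σ π s * (M.nominalValue π s - M.nominalValue π' s) =
        -∑ s, M.slopeWeight ρ σ π s * (M.nominalValue π' s - M.nominalValue π s) := by
      rw [← Finset.sum_neg_distrib]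
      exact Finset.sum_congr rfl fun s _ => by ring
    linarith
  have h2 : ∀ s, M.nominalValue π s - M.nominalValue π' s ≤
      (∑ s, ρ s * f s) / (⨅ s, ρ s) / (1 - M.β) := fun s => by
    have h := congrFun (nominalValue_sub (M := M) hπ hπ') s
    have h' := resolvent_le (M := M) hπ'
      (f := -fun s => ∑ a, (π' s a - π s a) * Q s a) (fun s => by
        refine le_trans ?_ (hb s)
        have := hmin hπ' s
        simp only [Pi.neg_apply, hfs, sub_mul, Finset.sum_sub_distrib]
        linarith) s
    rw [map_neg, Pi.neg_apply, ← h, Pi.sub_apply] at h'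
    linarith
  have h3 : ∑ s, ρ s * f s ≤ M.slope ρ σ π
      (fun s a => π s a - (Pi.single (g s) 1 : A → ℝ) a) :=
    Finset.sum_le_sum fun s _ =>
      mul_le_mul (le_slopeWeight σ s) (le_resolvent hπ hf0 s) (hf0 s) (hν s)
  calc _ ≤ ∑ s, M.slopeWeight ρ σ π s * (M.nominalValue π s - M.nominalValue π' s) := h1
    _ ≤ ∑ s, M.slopeWeight ρ σ π s * ((∑ s, ρ s * f s) / (⨅ s, ρ s) / (1 - M.β)) :=
        Finset.sum_le_sum fun s _ => mul_le_mul_of_nonneg_left (h2 s) (hν s)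
    _ = M.CPL ρ * ∑ s, ρ s * f s := by
        rw [← Finset.sum_mul, sum_slopeWeight hρ, CPL, worstWeight]
        -- The mass 1 + w of the slope weights cancels the resolvent factor 1/(1-β) and leaves
        -- 1/(1-γ).
        have e : 1 + M.γ * M.R / (1 - M.γ) = (1 - M.β) / (1 - M.γ) := by
          rw [one_sub_β]; field_simp
        rw [e]
        have := hinf.ne'
        field_simp
    _ ≤ _ := mul_le_mul_of_nonneg_left h3 (by rw [CPL]; positivity)

end

end RobustMDP

end

section

variable {S A : Type*} [Fintype S] [Fintype A]

/-! ### Parameters and projection -/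

lemma convex_directParams : Convex ℝ (directParams S A) := by
  intro x hx y hy a b ha hb hab s
  exact convex_stdSimplex ℝ A (hx s) (hy s) ha hb hab

lemma isClosed_directParams : IsClosed (directParams S A) := by
  have : directParams S A = ⋂ s, (fun θ : EuclideanSpace ℝ (S × A) => fun a => θ (s, a)) ⁻¹'
      stdSimplex ℝ A := by
    ext θ
    simp [directParams]
  rw [this]
  exact isClosed_iInter fun s => (isClosed_stdSimplex ℝ A).preimage (by fun_prop)

/-- For x, y in [0,1] one has (x - y)² ≤ x + y, so each state contributes at most 2. -/
lemma norm_sub_sq_le_of_mem_directParams {x y : EuclideanSpace ℝ (S × A)}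
    (hx : x ∈ directParams S A) (hy : y ∈ directParams S A) :
    ‖x - y‖ ^ 2 ≤ 2 * Fintype.card S := by
  rw [EuclideanSpace.norm_sq_eq, Fintype.sum_prod_type]
  have : ∀ s, ∑ a, ‖(x - y) (s, a)‖ ^ 2 ≤ 2 := fun s => by
    have h1 : ∑ a, (x (s, a) + y (s, a)) = 2 := by
      rw [Finset.sum_add_distrib, (hx s).2, (hy s).2]; norm_num
    rw [← h1]
    refine Finset.sum_le_sum fun a _ => ?_
    have hx0 : 0 ≤ x (s, a) := (hx s).1 a
    have hy0 : 0 ≤ y (s, a) := (hy s).1 a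
    have hx1 : x (s, a) ≤ 1 := (mem_Icc_of_mem_stdSimplex (hx s) a).2
    have hy1 : y (s, a) ≤ 1 := (mem_Icc_of_mem_stdSimplex (hy s) a).2
    rw [Real.norm_eq_abs, sq_abs, PiLp.sub_apply]
    nlinarith [mul_nonneg hx0 hy0]
  calc _ ≤ ∑ _s : S, (2 : ℝ) := Finset.sum_le_sum fun s _ => this s
    _ = _ := by rw [Finset.sum_const, Finset.card_univ, nsmul_eq_mul, mul_comm]

lemma sum_abs_sub_le_norm (x y : EuclideanSpace ℝ (S × A)) (s : S) :
    ∑ a, |x (s, a) - y (s, a)| ≤ Fintype.card A * ‖x - y‖ := by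
  calc _ ≤ ∑ _a : A, ‖x - y‖ := Finset.sum_le_sum fun a _ => PiLp.norm_apply_le (x - y) (s, a)
    _ = _ := by rw [Finset.sum_const, Finset.card_univ, nsmul_eq_mul]

section Projection

variable {E : Type*} [NormedAddCommGroup E]

lemma proj_spec [ProperSpace E] {K : Set E} (hK : IsClosed K) (hne : K.Nonempty) (x : E) :
    proj K x ∈ K ∧ ∀ z ∈ K, ‖x - proj K x‖ ≤ ‖x - z‖ := by
  refine Classical.epsilon_spec (p := fun y => y ∈ K ∧ ∀ z ∈ K, ‖x - y‖ ≤ ‖x - z‖) ?_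
  obtain ⟨y, hy, h⟩ := hK.exists_infDist_eq_dist hne x
  refine ⟨y, hy, fun z hz => ?_⟩
  rw [← dist_eq_norm, ← dist_eq_norm, ← h]
  exact Metric.infDist_le_dist_of_mem hz

/-- A projected gradient step minimizes the quadratic model of the objective. -/
lemma proj_step_le [InnerProductSpace ℝ E] [ProperSpace E] {K : Set E} (hK : IsClosed K) {L : ℝ}
    (hL : 0 < L) (x g : E) {z : E} (hz : z ∈ K) :
    inner ℝ g (proj K (x - (1 / L) • g) - x) + L / 2 * ‖proj K (x - (1 / L) • g) - x‖ ^ 2 ≤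
      inner ℝ g (z - x) + L / 2 * ‖z - x‖ ^ 2 := by
  have h := (proj_spec hK ⟨z, hz⟩ (x - (1 / L) • g)).2 z hz
  have h2 := pow_le_pow_left₀ (norm_nonneg _) h 2
  -- Completing the square: up to a term independent of w and the factor L/2, the squared distance
  -- to the gradient step is the quadratic model.
  have e : ∀ w : E, ‖x - (1 / L) • g - w‖ ^ 2 =
      ‖w - x‖ ^ 2 + 2 / L * inner ℝ g (w - x) + ‖(1 / L) • g‖ ^ 2 := fun w => by
    have : x - (1 / L) • g - w = -((w - x) + (1 / L) • g) := by abel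
    rw [this, norm_neg, norm_add_sq_real, inner_smul_right, real_inner_comm]
    ring
  rw [e, e] at h2
  have h3 := mul_le_mul_of_nonneg_left h2 (by positivity : 0 ≤ L / 2)
  have e' : ∀ p i r : ℝ, L / 2 * (p + 2 / L * i + r) = L / 2 * p + i + L / 2 * r :=
    fun p i r => by field_simp
  rw [e', e'] at h3
  linarith

end Projection

/-- Fixed points of a contraction depend differentiably on a parameter. -/
lemma differentiableAt_of_isFixedPt {E F : Type*} [NormedAddCommGroup E] [NormedSpace ℝ E]
    [CompleteSpace E] [NormedAddCommGroup F] [NormedSpace ℝ F] [CompleteSpace F]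
    {Φ : E × F → F} (hΦ : ContDiff ℝ 1 Φ) {θ : E} {K : NNReal} (hK : (K : ℝ) < 1)
    (hlip : LipschitzWith K fun W => Φ (θ, W)) {V : F} (hV : Φ (θ, V) = V) {v : E → F}
    (hv : ∀ᶠ η in 𝓝 θ, ∀ W, Φ (η, W) = W → v η = W) : DifferentiableAt ℝ v θ := by
  let f : E × F → F := fun w => Φ w - w.2
  have hf : ContDiff ℝ 1 f := hΦ.sub contDiff_snd
  have hfs : HasStrictFDerivAt f (fderiv ℝ f (θ, V)) (θ, V) :=
    hf.contDiffAt.hasStrictFDerivAt one_ne_zero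
  have hd : DifferentiableAt ℝ (fun W => Φ (θ, W)) V :=
    ((hΦ.comp (contDiff_prodMk_right θ)).differentiable one_ne_zero).differentiableAt
  have hDn : ‖fderiv ℝ (fun W => Φ (θ, W)) V‖ < 1 :=
    (norm_fderiv_le_of_lipschitz ℝ hlip).trans_lt hK
  -- The partial derivative in the fixed-point variable is D - 1 with ‖D‖ < 1, so the implicit
  -- function theorem applies.
  have hpart : fderiv ℝ f (θ, V) ∘L .inr ℝ E F = fderiv ℝ (fun W => Φ (θ, W)) V - 1 := by
    have h1 : HasFDerivAt (fun W : F => f (θ, W)) (fderiv ℝ f (θ, V) ∘L .inr ℝ E F) V :=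
      hfs.hasFDerivAt.comp V (hasFDerivAt_prodMk_right θ V)
    exact h1.unique (hd.hasFDerivAt.sub (hasFDerivAt_id V))
  have hinv : (fderiv ℝ f (θ, V) ∘L .inr ℝ E F).IsInvertible := by
    obtain ⟨u, hu⟩ := (isUnit_one_sub_of_norm_lt_one hDn).neg
    rw [neg_sub] at hu
    rw [hpart, ← hu]
    exact ⟨ContinuousLinearEquiv.ofUnit u, rfl⟩
  have hψ := (hfs.hasStrictFDerivAt_implicitFunctionOfProdDomain hinv).hasFDerivAt.differentiableAt
  refine hψ.congr_of_eventuallyEq ?_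
  have hzero : f (θ, V) = 0 := sub_eq_zero.2 hV
  -- Uniqueness of nearby fixed points identifies v with the implicit function.
  filter_upwards [hv, hfs.eventually_apply_implicitFunctionOfProdDomain hinv] with η h1 h2
  rw [hzero] at h2
  exact h1 _ (sub_eq_zero.1 h2)

namespace RobustMDP

variable {M : RobustMDP S A} {ρ : S → ℝ} {σ : ℝ}

lemma srpg_mem (ρ : S → ℝ) (σ α : ℝ) {θ₀ : EuclideanSpace ℝ (S × A)} (hθ₀ : θ₀ ∈ directParams S A)
    (t : ℕ) : M.srpg ρ σ α θ₀ t ∈ directParams S A := by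
  cases t with
  | zero => exact hθ₀
  | succ t => exact (proj_spec isClosed_directParams ⟨θ₀, hθ₀⟩ _).1

/-! ### Differentiability of the smoothed objective -/

lemma contDiff_smoothedBellman [Nonempty S] (σ : ℝ) :
    ContDiff ℝ 1 fun v : EuclideanSpace ℝ (S × A) × (S → ℝ) =>
      M.smoothedBellman σ (directPolicy v.1) v.2 := by
  have h : ContDiff ℝ 1 fun v : EuclideanSpace ℝ (S × A) × (S → ℝ) => LSE σ v.2 :=
    (contDiff_LSE σ).comp contDiff_snd
  unfold smoothedBellman directPolicy
  fun_prop

/-- The closed form holds only on policies, whereas the gradient is taken in the ambient space,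
where Θ is thin. Differentiability therefore comes from the fixed-point equation. -/
lemma differentiableAt_smoothedValue [Nonempty S] (hσ : 0 < σ) {θ : EuclideanSpace ℝ (S × A)}
    (hθ : θ ∈ directParams S A) :
    DifferentiableAt ℝ (fun η => M.smoothedValue σ (directPolicy η)) θ := by
  have hπ : IsPolicy (directPolicy θ) := hθ
  have hK : (M.γ.toNNReal : ℝ) = M.γ := Real.coe_toNNReal _ M.γ_nonneg
  have hlip : LipschitzWith M.γ.toNNReal (M.smoothedBellman σ (directPolicy θ)) := by
    refine LipschitzWith.of_dist_le_mul fun W W' => ?_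
    rw [dist_eq_norm, dist_eq_norm, hK]
    simpa only [one_mul] using norm_smoothedBellman_sub_le (M := M) hσ zero_le_one
      (fun s => (hπ.sum_abs s).le) W W'
  obtain ⟨b, hb1, hb2⟩ : ∃ b : ℝ, 1 < b ∧ b * M.γ < 1 := by
    -- A number above 1 whose product with γ is below 1, chosen so that γ = 0 needs no separate
    -- case.
    refine ⟨2 / (1 + M.γ), ?_, ?_⟩
    · rw [lt_div_iff₀ (by linarith [M.γ_nonneg])]; linarith [M.γ_lt_one]
    · rw [div_mul_eq_mul_div, div_lt_one (by linarith [M.γ_nonneg])]; linarith [M.γ_lt_one]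
  have hnear : ∀ᶠ η in 𝓝 θ, ∀ s, ∑ a, |directPolicy η s a| < b := by
    refine eventually_all.2 fun s => ?_
    have hc : Continuous fun η : EuclideanSpace ℝ (S × A) => ∑ a, |directPolicy η s a| := by
      unfold directPolicy
      fun_prop
    exact hc.continuousAt.eventually_lt continuousAt_const (by rw [hπ.sum_abs s]; exact hb1)
  have hv : ∀ᶠ η in 𝓝 θ, ∀ W, M.smoothedBellman σ (directPolicy η) W = W →
      M.smoothedValue σ (directPolicy η) = W := by
    filter_upwards [hnear] with η h1 W hW
    exact smoothedValue_eq_of_isFixedPt hσ (zero_le_one.trans hb1.le) hb2 (fun s => (h1 s).le) hW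
  have hV : ∃ V, M.smoothedBellman σ (directPolicy θ) V = V := ⟨_, isFixedPt_smoothedBellman hσ hπ⟩
  obtain ⟨V, hV⟩ := hV
  have hΦ := contDiff_smoothedBellman (M := M) σ
  generalize M.smoothedValue σ = v at hv ⊢
  generalize M.smoothedBellman σ = Φ at *
  exact differentiableAt_of_isFixedPt hΦ (hK.trans_lt M.γ_lt_one) hlip hV hv

lemma differentiableAt_Jσ [Nonempty S] (ρ : S → ℝ) (hσ : 0 < σ) {θ : EuclideanSpace ℝ (S × A)}
    (hθ : θ ∈ directParams S A) : DifferentiableAt ℝ (M.Jσ ρ σ) θ := by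
  have h := differentiableAt_pi.1 (differentiableAt_smoothedValue (M := M) hσ hθ)
  unfold Jσ
  exact DifferentiableAt.fun_sum fun s _ => (h s).const_mul (ρ s)

lemma Jσ_eq [Nonempty S] (hρ : ρ ∈ stdSimplex ℝ S) (hσ : 0 < σ) {θ : EuclideanSpace ℝ (S × A)}
    (hθ : θ ∈ directParams S A) : M.Jσ ρ σ θ = M.smoothedObjective ρ σ (directPolicy θ) :=
  sum_smoothedValue hρ hσ hθ

variable (M) in
/-- Half of a smoothness constant of the smoothed objective. -/
def curvature (σ : ℝ) : ℝ :=
  ((1 + M.worstWeight) * (M.β / (1 - M.β) ^ 3) + M.worstWeight * (σ / (2 * (1 - M.β) ^ 4))) *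
    (Fintype.card A : ℝ) ^ 2

lemma abs_Jσ_remainder_le [Nonempty S] (hρ : ρ ∈ stdSimplex ℝ S) (hσ : 0 < σ)
    {x y : EuclideanSpace ℝ (S × A)} (hx : x ∈ directParams S A) (hy : y ∈ directParams S A) :
    |M.Jσ ρ σ y - M.Jσ ρ σ x - M.slope ρ σ (directPolicy x) (directPolicy (y - x))| ≤
      M.curvature σ * ‖y - x‖ ^ 2 := by
  rw [Jσ_eq hρ hσ hx, Jσ_eq hρ hσ hy, curvature, mul_assoc, ← mul_pow]
  exact abs_smoothedObjective_remainder_le hρ hσ hx hy (sum_abs_sub_le_norm y x)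

/-- Along the segment from x to y, the ambient gradient and the expansion valid on Θ both give a
one-sided derivative at 0, and that derivative is unique. -/
lemma inner_gradient_Jσ [Nonempty S] (hρ : ρ ∈ stdSimplex ℝ S) (hσ : 0 < σ)
    {x y : EuclideanSpace ℝ (S × A)} (hx : x ∈ directParams S A) (hy : y ∈ directParams S A) :
    inner ℝ (gradient (M.Jσ ρ σ) x) (y - x) =
      M.slope ρ σ (directPolicy x) (directPolicy (y - x)) := by
  set ℓ := M.slope ρ σ (directPolicy x) (directPolicy (y - x))
  have h1 : HasDerivAt (fun t : ℝ => M.Jσ ρ σ (x + t • (y - x)))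
      (inner ℝ (gradient (M.Jσ ρ σ) x) (y - x)) 0 := by
    have hg : HasFDerivAt (M.Jσ ρ σ) (fderiv ℝ (M.Jσ ρ σ) x) (x + (0 : ℝ) • (y - x)) := by
      rw [zero_smul, add_zero]
      exact (differentiableAt_Jσ ρ hσ hx).hasFDerivAt
    have hl : HasDerivAt (fun t : ℝ => x + t • (y - x)) (y - x) 0 := by
      simpa using ((hasDerivAt_id (0 : ℝ)).smul_const (y - x)).const_add x
    rw [gradient, InnerProductSpace.toDual_symm_apply]
    exact hg.comp_hasDerivAt 0 hl
  have h2 : HasDerivWithinAt (fun t : ℝ => M.Jσ ρ σ (x + t • (y - x))) ℓ (Set.Icc 0 1) 0 := by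
    rw [hasDerivWithinAt_iff_isLittleO]
    have hO : (fun t : ℝ => M.Jσ ρ σ (x + t • (y - x)) - M.Jσ ρ σ (x + (0 : ℝ) • (y - x)) -
        (t - 0) • ℓ) =O[𝓝[Set.Icc 0 1] 0] fun t : ℝ => t ^ 2 := by
      refine IsBigO.of_bound (M.curvature σ * ‖y - x‖ ^ 2) ?_
      filter_upwards [self_mem_nhdsWithin] with t ht
      have hm : x + t • (y - x) ∈ directParams S A :=
        convex_directParams.add_smul_sub_mem hx hy ht
      have h := abs_Jσ_remainder_le (M := M) hρ hσ hx hm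
      have e : M.slope ρ σ (directPolicy x) (directPolicy (x + t • (y - x) - x)) = t * ℓ := by
        rw [add_sub_cancel_left]
        exact slope_smul ρ σ _ (directPolicy (y - x)) t
      rw [e, add_sub_cancel_left, norm_smul, mul_pow, Real.norm_eq_abs, sq_abs] at h
      simp only [zero_smul, add_zero, sub_zero, smul_eq_mul, norm_pow, Real.norm_eq_abs, sq_abs]
      linarith
    refine hO.trans_isLittleO ?_
    have := (isLittleO_pow_id (𝕜 := ℝ) one_lt_two).mono
      (nhdsWithin_le_nhds (a := (0 : ℝ)) (s := Set.Icc 0 1))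
    simpa using this
  exact UniqueDiffWithinAt.eq_deriv _ (uniqueDiffOn_Icc_zero_one 0 (by simp))
    h1.hasDerivWithinAt h2

/-! ### One step of smoothed robust policy gradient -/

/-- The projected step is compared with the Frank–Wolfe point x + η(z - x). The last term is (L/2)η²
times the bound 2|S| on the squared distance. -/
lemma Jσ_srpg_succ_le [Nonempty S] (hρ : ρ ∈ stdSimplex ℝ S) (hσ : 0 < σ) {L : ℝ} (hL : 0 < L)
    (hLc : M.curvature σ ≤ L / 2) {θ₀ : EuclideanSpace ℝ (S × A)} (hθ₀ : θ₀ ∈ directParams S A)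
    (t : ℕ) {z : EuclideanSpace ℝ (S × A)} (hz : z ∈ directParams S A) {η : ℝ}
    (hη : η ∈ Set.Icc (0 : ℝ) 1) :
    M.Jσ ρ σ (M.srpg ρ σ (1 / L) θ₀ (t + 1)) ≤ M.Jσ ρ σ (M.srpg ρ σ (1 / L) θ₀ t) -
      η * M.slope ρ σ (directPolicy (M.srpg ρ σ (1 / L) θ₀ t))
        (directPolicy (M.srpg ρ σ (1 / L) θ₀ t - z)) + η ^ 2 * (L * Fintype.card S) := by
  have hx := srpg_mem (M := M) ρ σ (1 / L) hθ₀ t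
  have hy := srpg_mem (M := M) ρ σ (1 / L) hθ₀ (t + 1)
  have hstep := proj_step_le (K := directParams S A) isClosed_directParams hL
    (M.srpg ρ σ (1 / L) θ₀ t) (gradient (M.Jσ ρ σ) (M.srpg ρ σ (1 / L) θ₀ t))
    (convex_directParams.add_smul_sub_mem hx hz hη)
  rw [← srpg] at hstep
  set x := M.srpg ρ σ (1 / L) θ₀ t
  set y := M.srpg ρ σ (1 / L) θ₀ (t + 1)
  have h1 := (abs_le.1 (abs_Jσ_remainder_le (M := M) hρ hσ hx hy)).2
  have h2 : M.curvature σ * ‖y - x‖ ^ 2 ≤ L / 2 * ‖y - x‖ ^ 2 :=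
    mul_le_mul_of_nonneg_right hLc (sq_nonneg _)
  have h3 : M.slope ρ σ (directPolicy x) (directPolicy (x - z)) =
      -M.slope ρ σ (directPolicy x) (directPolicy (z - x)) := by
    have := slope_smul (M := M) ρ σ (directPolicy x) (directPolicy (z - x)) (-1)
    rw [neg_one_mul] at this
    rw [← this]
    congr 1
    ext s a
    simp [directPolicy]
  rw [← inner_gradient_Jσ hρ hσ hx hy] at h1
  rw [h3, ← inner_gradient_Jσ hρ hσ hx hz]
  rw [add_sub_cancel_left, inner_smul_right, norm_smul, mul_pow, Real.norm_eq_abs, sq_abs]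
    at hstep
  have h4 := mul_le_mul_of_nonneg_left (norm_sub_sq_le_of_mem_directParams hz hx)
    (by positivity : 0 ≤ L / 2 * η ^ 2)
  nlinarith

end RobustMDP

end

/-! ### Direct parametrization, the constants, convergence and rates -/

section

variable {S A : Type*} [Fintype S]

lemma directParams_nonempty [Fintype A] [Nonempty A] : (directParams S A).Nonempty := by
  classical
  obtain ⟨a₀⟩ := ‹Nonempty A›
  refine ⟨WithLp.toLp 2 fun i : S × A => (Pi.single a₀ 1 : A → ℝ) i.2, fun s => ?_⟩
  exact single_mem_stdSimplex ℝ a₀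

/-- The gradient of a coordinate is a unit vector. -/
lemma IsLipschitzPolicyClass.one_le [Fintype A] [Nonempty S] [Nonempty A] {k : ℝ}
    (hk : IsLipschitzPolicyClass (directParams S A) (directPolicy (S := S) (A := A)) k) :
    1 ≤ k := by
  classical
  obtain ⟨s⟩ := ‹Nonempty S›
  obtain ⟨θ, hθ⟩ := directParams_nonempty (S := S) (A := A)
  obtain ⟨a⟩ := ‹Nonempty A›
  have hf : HasFDerivAt (fun η : EuclideanSpace ℝ (S × A) => directPolicy η s a)
      (EuclideanSpace.proj (𝕜 := ℝ) (s, a)) θ :=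
    (EuclideanSpace.proj (𝕜 := ℝ) (s, a) : EuclideanSpace ℝ (S × A) →L[ℝ] ℝ).hasFDerivAt
  have h1 : inner ℝ (gradient (fun η : EuclideanSpace ℝ (S × A) => directPolicy η s a) θ)
      (EuclideanSpace.single (s, a) (1 : ℝ)) = 1 := by
    rw [gradient, InnerProductSpace.toDual_symm_apply, hf.fderiv]
    simp
  have h2 := real_inner_le_norm
    (gradient (fun η : EuclideanSpace ℝ (S × A) => directPolicy η s a) θ)
    (EuclideanSpace.single (s, a) (1 : ℝ))
  rw [h1, PiLp.norm_single, norm_one, mul_one] at h2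
  exact h2.trans (hk s a θ hθ).2

namespace RobustMDP

variable {M : RobustMDP S A} {ρ : S → ℝ} {σ k l : ℝ}

/-! ### The constants -/

lemma log_card_nonneg [Nonempty S] : 0 ≤ Real.log (Fintype.card S) :=
  Real.log_nonneg (by exact_mod_cast Fintype.card_pos)

lemma one_div_le_Cσ [Nonempty S] (hσ : 0 < σ) : 1 / (1 - M.γ) ≤ M.Cσ σ := by
  have h1 := div_nonneg (log_card_nonneg (S := S)) hσ.le
  have h2 : 0 ≤ 2 * M.γ * M.R * (Real.log (Fintype.card S) / σ) := by
    rw [mul_assoc 2]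
    exact mul_nonneg (mul_nonneg two_pos.le M.γR_nonneg) h1
  have h3 : 0 ≤ 1 / (1 - M.γ) := by have := M.one_sub_γ_pos; positivity
  rw [Cσ]
  exact le_mul_of_one_le_right h3 (by linarith)

lemma one_le_one_div_one_sub_β : 1 ≤ 1 / (1 - M.β) := by
  rw [le_div_iff₀ M.one_sub_β_pos]
  linarith [M.β_nonneg]

lemma one_div_one_sub_β_le : 1 / (1 - M.β) ≤ 1 / (1 - M.γ) :=
  one_div_le_one_div_of_le M.one_sub_γ_pos M.one_sub_γ_le

lemma one_le_CPL [Nonempty S] (hρ : ρ ∈ stdSimplex ℝ S) (hρ_pos : ∀ s, 0 < ρ s) :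
    1 ≤ M.CPL ρ := by
  obtain ⟨s, hs⟩ := exists_eq_ciInf_of_finite (f := ρ)
  have h1 := (mem_Icc_of_mem_stdSimplex hρ s).2
  have h0 := hρ_pos s
  have hγ := M.one_sub_γ_pos
  rw [CPL, ← hs, le_div_iff₀ (by positivity)]
  nlinarith [M.γ_nonneg]

lemma smoothing_pos [Nonempty S] {σ₀ ε : ℝ} (hσ₀ : 0 < σ₀) (hε : 0 < ε) :
    0 < M.smoothing σ₀ ε := by
  rw [smoothing]
  split_ifs with h
  · exact hσ₀
  · have h1 : 0 < M.γ * M.R * Real.log (Fintype.card S) :=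
      lt_of_le_of_ne (mul_nonneg M.γR_nonneg log_card_nonneg) (Ne.symm h)
    have h2 := M.one_sub_γ_pos
    refine div_pos ?_ (mul_pos hε h2)
    linarith

/-- The choice of σ makes this an equality, except in the degenerate case, where the bias vanishes.
-/
lemma smoothing_bias_le {σ₀ ε : ℝ} (hε : 0 < ε) :
    M.worstWeight * (Real.log (Fintype.card S) / M.smoothing σ₀ ε) ≤ ε / 2 := by
  have h2 := M.one_sub_γ_pos
  rw [smoothing, worstWeight]
  split_ifs with h
  · have : M.γ * M.R / (1 - M.γ) * (Real.log (Fintype.card S) / σ₀) =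
        M.γ * M.R * Real.log (Fintype.card S) / ((1 - M.γ) * σ₀) := by
      field_simp
    rw [this, h, zero_div]
    positivity
  · refine le_of_eq ?_
    obtain ⟨⟨h3, h4⟩, h5⟩ : (M.γ ≠ 0 ∧ M.R ≠ 0) ∧ Real.log (Fintype.card S) ≠ 0 := by
      simpa [mul_eq_zero, not_or] using h
    have := h2.ne'
    field_simp

lemma one_isBigO_inv : (fun _ : ℝ => (1 : ℝ)) =O[𝓝[>] 0] fun ε : ℝ => ε⁻¹ := by
  refine IsBigO.of_bound 1 ?_
  filter_upwards [Ioo_mem_nhdsGT (zero_lt_one' ℝ)] with ε hε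
  rw [norm_one, one_mul, norm_inv, Real.norm_of_nonneg hε.1.le]
  exact (one_le_inv₀ hε.1).2 hε.2.le

lemma smoothing_isBigO (M : RobustMDP S A) (σ₀ : ℝ) :
    (fun ε : ℝ => M.smoothing σ₀ ε) =O[𝓝[>] 0] fun ε : ℝ => ε⁻¹ := by
  unfold smoothing
  split_ifs with h
  · exact (isBigO_const_const σ₀ one_ne_zero _).trans one_isBigO_inv
  · have : (fun ε : ℝ => 2 * M.γ * M.R * Real.log (Fintype.card S) / (ε * (1 - M.γ))) =
        fun ε => 2 * M.γ * M.R * Real.log (Fintype.card S) / (1 - M.γ) * ε⁻¹ := by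
      ext ε
      rw [div_mul_eq_div_div_swap]
      ring
    rw [this]
    exact isBigO_const_mul_self _ _ _

/-- Off the degenerate case the quotient is a multiple of ε; this keeps `Cσ` bounded although σ
varies. -/
lemma log_card_div_smoothing_isBigO (M : RobustMDP S A) (σ₀ : ℝ) :
    (fun ε : ℝ => Real.log (Fintype.card S) / M.smoothing σ₀ ε) =O[𝓝[>] 0]
      fun _ : ℝ => (1 : ℝ) := by
  unfold smoothing
  split_ifs with h
  · exact isBigO_const_const _ one_ne_zero _
  · have : (fun ε : ℝ => Real.log (Fintype.card S) /
        (2 * M.γ * M.R * Real.log (Fintype.card S) / (ε * (1 - M.γ)))) =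
        fun ε => Real.log (Fintype.card S) /
          (2 * M.γ * M.R * Real.log (Fintype.card S)) * (1 - M.γ) * ε := by
      ext ε
      rw [div_div_eq_mul_div]
      ring
    rw [this]
    refine IsBigO.const_mul_left ?_ _
    exact (tendsto_id.mono_left nhdsWithin_le_nhds : Tendsto id (𝓝[>] (0 : ℝ)) (𝓝 0)).isBigO_one ℝ

lemma Cσ_isBigO (M : RobustMDP S A) (σ₀ : ℝ) :
    (fun ε : ℝ => M.Cσ (M.smoothing σ₀ ε)) =O[𝓝[>] 0] fun _ : ℝ => (1 : ℝ) := by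
  unfold Cσ
  exact ((isBigO_refl _ _).add ((M.log_card_div_smoothing_isBigO σ₀).const_mul_left _)).const_mul_left _

variable [Fintype A]

lemma kB_eq (k l σ : ℝ) : M.kB k l σ = 1 / (1 - M.β) * (Fintype.card A * M.Cσ σ * l +
    Fintype.card A * k * M.CVσ k σ) +
      2 * (Fintype.card A : ℝ) ^ 2 * M.β * (1 / (1 - M.β)) ^ 2 * k ^ 2 * M.Cσ σ := by
  rw [kB, ← one_sub_β]
  generalize 1 - M.β = d
  rw [β]
  ring

section

variable [Nonempty S]

/-- The first bound comes from the summand with `CVσ`, the second from the last summand, using k ≥ 1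
and C_σ ≥ 1/(1-β). -/
lemma kB_bounds [Nonempty A] (hσ : 0 < σ) (hk : 1 ≤ k) (hl : 0 ≤ l) :
    M.Cσ σ ≤ M.kB k l σ ∧
      2 * (Fintype.card A : ℝ) ^ 2 * M.β * (1 / (1 - M.β)) ^ 3 ≤ M.kB k l σ := by
  have hD1 := M.one_le_one_div_one_sub_β
  have hDG := M.one_div_one_sub_β_le
  have hGC := one_div_le_Cσ (M := M) hσ
  have hβ := M.β_nonneg
  have hq : (1 : ℝ) ≤ Fintype.card A := by exact_mod_cast Fintype.card_pos
  rw [kB_eq, CVσ]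
  set D := 1 / (1 - M.β)
  set G := 1 / (1 - M.γ)
  set C := M.Cσ σ
  set q : ℝ := (Fintype.card A : ℝ)
  have hG1 : 1 ≤ G := hD1.trans hDG
  have hC1 : 1 ≤ C := hG1.trans hGC
  have t1 : 0 ≤ D * (q * C * l) := by positivity
  have t2 : 0 ≤ D * (q * k * (G * q * k * C)) := by positivity
  have t3 : 0 ≤ 2 * q ^ 2 * M.β * D ^ 2 * k ^ 2 * C := by positivity
  constructor
  · have : C ≤ D * (q * k * (G * q * k * C)) := by
      have : D * (q * k * (G * q * k * C)) = (D * (q * k * (G * q * k))) * C := by ring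
      rw [this]
      refine le_mul_of_one_le_left (by positivity) ?_
      have h : 1 ≤ q * k := one_le_mul_of_one_le_of_one_le hq hk
      exact one_le_mul_of_one_le_of_one_le hD1 <| one_le_mul_of_one_le_of_one_le h <|
        one_le_mul_of_one_le_of_one_le (one_le_mul_of_one_le_of_one_le hG1 hq) hk
    linarith
  · have : 2 * q ^ 2 * M.β * D ^ 3 ≤ 2 * q ^ 2 * M.β * D ^ 2 * k ^ 2 * C := by
      calc 2 * q ^ 2 * M.β * D ^ 3 = 2 * q ^ 2 * M.β * D ^ 2 * 1 * D := by ring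
        _ ≤ _ := by
          gcongr
          · exact one_le_pow₀ hk
          · exact hDG.trans hGC
    linarith

/-- The curvature bound makes 1/L_σ an admissible step size. The bound by C_σ later keeps the
comparison parameter η at most 1. -/
lemma Lσ_bounds [Nonempty A] (hσ : 0 < σ) (hk : 1 ≤ k) (hl : 0 ≤ l) :
    M.Cσ σ ≤ M.Lσ k l σ ∧ M.curvature σ ≤ M.Lσ k l σ / 2 := by
  obtain ⟨hB1, hB2⟩ := kB_bounds (M := M) hσ hk hl
  have hD1 := M.one_le_one_div_one_sub_β
  have hDG := M.one_div_one_sub_β_le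
  have hGC := one_div_le_Cσ (M := M) hσ
  have hβ := M.β_nonneg
  have hW := M.worstWeight_nonneg
  have hδ := M.one_sub_β_pos
  have hq : (1 : ℝ) ≤ Fintype.card A := by exact_mod_cast Fintype.card_pos
  have hn : (1 : ℝ) ≤ Fintype.card S := by exact_mod_cast Fintype.card_pos
  have e : M.curvature σ = ((1 + M.worstWeight) * (M.β * (1 / (1 - M.β)) ^ 3) +
      M.worstWeight * (σ / 2 * (1 / (1 - M.β)) ^ 4)) * (Fintype.card A : ℝ) ^ 2 := by
    rw [curvature]
    field_simp
  rw [e, Lσ, ← one_sub_β, CVσ, ← worstWeight]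
  set B := M.kB k l σ
  set W := M.worstWeight
  set D := 1 / (1 - M.β)
  set G := 1 / (1 - M.γ)
  set C := M.Cσ σ
  set q : ℝ := (Fintype.card A : ℝ)
  set n : ℝ := (Fintype.card S : ℝ)
  have hG1 : 1 ≤ G := hD1.trans hDG
  have hC1 : 1 ≤ C := hG1.trans hGC
  have hDC : D ≤ C := hDG.trans hGC
  have hB0 : 0 ≤ B := by linarith
  have h1 : W * B ≤ W * (Real.sqrt n * B) := by
    refine mul_le_mul_of_nonneg_left (le_mul_of_one_le_left hB0 ?_) hW
    exact Real.one_le_sqrt.2 hn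
  have h2 : W * (2 * (σ * q ^ 2 * D ^ 4)) ≤ W * (2 * σ * n * (G * q * k * C) * D * k * q * C) := by
    refine mul_le_mul_of_nonneg_left ?_ hW
    calc 2 * (σ * q ^ 2 * D ^ 4) = 2 * σ * 1 * (D * q * 1 * D) * D * 1 * q * D := by ring
      _ ≤ _ := by gcongr
  have h3 : 0 ≤ W * (2 * (σ * q ^ 2 * D ^ 4)) := by positivity
  have h4 : 0 ≤ W * B := by positivity
  have h5 := mul_le_mul_of_nonneg_left hB2 (by positivity : 0 ≤ 1 + W)
  rw [mul_add W]
  constructor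
  · linarith
  · linarith

/-! ### Convergence -/

lemma smoothedObjective_nonneg (hρ : ρ ∈ stdSimplex ℝ S) (hσ : 0 < σ) {π : S → A → ℝ}
    (hπ : IsPolicy π) : 0 ≤ M.smoothedObjective ρ σ π := by
  obtain ⟨s⟩ := ‹Nonempty S›
  exact add_nonneg
    (Finset.sum_nonneg fun s _ => mul_nonneg (hρ.1 s) (nominalValue_nonneg hπ s)) <|
    mul_nonneg M.worstWeight_nonneg ((nominalValue_nonneg hπ s).trans (le_LSE hσ _ s))

lemma smoothedObjective_le (hρ : ρ ∈ stdSimplex ℝ S) (hσ : 0 < σ) {π : S → A → ℝ}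
    (hπ : IsPolicy π) : M.smoothedObjective ρ σ π ≤ M.Cσ σ := by
  have hδ := M.one_sub_β_pos
  have hγ := M.one_sub_γ_pos
  have h1 := sum_mul_le_of_mem_stdSimplex hρ (nominalValue_le (M := M) hπ)
  have h2 := mul_le_mul_of_nonneg_left (LSE_le_of_le hσ (nominalValue_le (M := M) hπ))
    M.worstWeight_nonneg
  have h3 : 0 ≤ M.worstWeight * (Real.log (Fintype.card S) / σ) :=
    mul_nonneg M.worstWeight_nonneg (div_nonneg log_card_nonneg hσ.le)
  have e1 : 1 / (1 - M.β) + M.worstWeight * (1 / (1 - M.β)) = 1 / (1 - M.γ) := by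
    have : 1 + M.worstWeight = (1 - M.β) / (1 - M.γ) := by
      rw [worstWeight, one_sub_β]; field_simp
    rw [← one_add_mul, this]
    field_simp
  have e2 : M.Cσ σ =
      1 / (1 - M.γ) + 2 * (M.worstWeight * (Real.log (Fintype.card S) / σ)) := by
    rw [Cσ, worstWeight]; ring
  rw [mul_add] at h2
  rw [e2, smoothedObjective]
  linarith

lemma exists_Jσ_srpg_sub_le [Nonempty A] (hρ : ρ ∈ stdSimplex ℝ S) (hρ_pos : ∀ s, 0 < ρ s) (hσ : 0 < σ)
    {L : ℝ} (hLC : M.Cσ σ ≤ L) (hLc : M.curvature σ ≤ L / 2) {ε : ℝ} (hε : 0 < ε)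
    {θ₀ : EuclideanSpace ℝ (S × A)} (hθ₀ : θ₀ ∈ directParams S A)
    {y : EuclideanSpace ℝ (S × A)} (hy : y ∈ directParams S A) {T : ℕ}
    (hT : 64 * Fintype.card S * M.CPL ρ ^ 2 * L * M.Cσ σ / ε ^ 2 ≤ T) :
    ∃ t < T, M.Jσ ρ σ (M.srpg ρ σ (1 / L) θ₀ t) - M.Jσ ρ σ y ≤ ε := by
  by_contra! hcon
  have hP := one_le_CPL (M := M) hρ hρ_pos
  have hC : 0 < M.Cσ σ :=
    (one_div_pos.2 M.one_sub_γ_pos).trans_le (one_div_le_Cσ (M := M) hσ)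
  have hL : 0 < L := hC.trans_le hLC
  have hn : (1 : ℝ) ≤ Fintype.card S := by exact_mod_cast Fintype.card_pos
  have hmem := srpg_mem (M := M) ρ σ (1 / L) hθ₀
  have hJ0 : ∀ {x}, x ∈ directParams S A → 0 ≤ M.Jσ ρ σ x := fun {x} hx => by
    rw [Jσ_eq hρ hσ hx]; exact smoothedObjective_nonneg hρ hσ hx
  have hJC : ∀ {x}, x ∈ directParams S A → M.Jσ ρ σ x ≤ M.Cσ σ := fun {x} hx => by
    rw [Jσ_eq hρ hσ hx]; exact smoothedObjective_le hρ hσ hx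
  set J := fun t => M.Jσ ρ σ (M.srpg ρ σ (1 / L) θ₀ t) with hJ
  set C := M.Cσ σ
  set P := M.CPL ρ
  set n : ℝ := (Fintype.card S : ℝ)
  have hT0 : 0 < T := by
    have : (0 : ℝ) < T := lt_of_lt_of_le (by positivity) hT
    exact_mod_cast this
  -- The maximizer of η(ε/P) - η²L|S|, the decrease guaranteed by gradient dominance.
  set η := ε / (2 * n * L * P) with hη
  have hη1 : η ≤ 1 := by
    rw [hη, div_le_one (by positivity)]
    -- The gap at time 0 exceeds ε but is at most C_σ ≤ L, so ε < L.
    have h1 := hcon 0 hT0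
    have h2 := hJC (hmem 0)
    have h3 := hJ0 hy
    have h4 : 1 * L * 1 ≤ 2 * n * L * P := by gcongr; linarith
    linarith
  have hη0 : 0 ≤ η := by positivity
  have hstep : ∀ t < T, J (t + 1) ≤ J t - ε ^ 2 / (4 * n * L * P ^ 2) := fun t ht => by
    obtain ⟨ψ, hψ, hdom⟩ := smoothedObjective_sub_le_slope (M := M) hρ hρ_pos hσ
      (show IsPolicy (directPolicy (M.srpg ρ σ (1 / L) θ₀ t)) from hmem t)
    have h1 := hdom (directPolicy y) hy
    rw [← Jσ_eq hρ hσ (hmem t), ← Jσ_eq hρ hσ hy] at h1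
    have h2 := hcon t ht
    have h3 := Jσ_srpg_succ_le (M := M) hρ hσ hL hLc hθ₀ t
      (z := WithLp.toLp 2 fun i : S × A => ψ i.1 i.2) hψ ⟨hη0, hη1⟩
    have e : directPolicy (M.srpg ρ σ (1 / L) θ₀ t - WithLp.toLp 2 fun i : S × A => ψ i.1 i.2) =
        fun s a => directPolicy (M.srpg ρ σ (1 / L) θ₀ t) s a - ψ s a := rfl
    rw [e] at h3
    set m := M.slope ρ σ (directPolicy (M.srpg ρ σ (1 / L) θ₀ t))
      (fun s a => directPolicy (M.srpg ρ σ (1 / L) θ₀ t) s a - ψ s a)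
    have h4 : ε / P ≤ m := by
      rw [div_le_iff₀ (by positivity)]
      linarith
    have h5 := mul_le_mul_of_nonneg_left h4 hη0
    have h6 : η * (ε / P) - η ^ 2 * (L * n) = ε ^ 2 / (4 * n * L * P ^ 2) := by
      rw [hη]
      field_simp
      ring
    have h7 : J (t + 1) ≤ J t - η * m + η ^ 2 * (L * n) := h3
    linarith
  have hind : ∀ t ≤ T, J t ≤ J 0 - t * (ε ^ 2 / (4 * n * L * P ^ 2)) := fun t => by
    induction t with
    | zero => simp
    | succ t ih =>
      intro ht
      have h1 := hstep t ht
      have h2 := ih (Nat.le_of_succ_le ht)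
      push_cast
      linarith
  have h1 := hind T le_rfl
  have h2 : 0 ≤ J T := hJ0 (hmem T)
  have h3 : J 0 ≤ C := hJC (hmem 0)
  have h4 := mul_le_mul_of_nonneg_right hT (by positivity : 0 ≤ ε ^ 2 / (4 * n * L * P ^ 2))
  -- The accumulated decrease is at least 16 C_σ, while only C_σ is available.
  have h5 : 64 * n * P ^ 2 * L * C / ε ^ 2 * (ε ^ 2 / (4 * n * L * P ^ 2)) = 16 * C := by
    field_simp
    norm_num
  linarith

lemma J_le_Jσ (hρ : ρ ∈ stdSimplex ℝ S) (hσ : 0 < σ) {θ : EuclideanSpace ℝ (S × A)}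
    (hθ : θ ∈ directParams S A) : M.J ρ θ ≤ M.Jσ ρ σ θ :=
  Finset.sum_le_sum fun s _ =>
    mul_le_mul_of_nonneg_left (robustValue_le_smoothedValue hσ hθ s) (hρ.1 s)

lemma Jσ_le_J_add (hρ : ρ ∈ stdSimplex ℝ S) (hσ : 0 < σ) {θ : EuclideanSpace ℝ (S × A)}
    (hθ : θ ∈ directParams S A) :
    M.Jσ ρ σ θ ≤ M.J ρ θ + M.worstWeight * (Real.log (Fintype.card S) / σ) := by
  rw [J, ← sum_mul_const_of_mem_stdSimplex hρ (M.worstWeight * _), ← Finset.sum_add_distrib]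
  refine Finset.sum_le_sum fun s _ => ?_
  rw [← mul_add]
  exact mul_le_mul_of_nonneg_left (smoothedValue_le_robustValue_add hσ hθ s) (hρ.1 s)

theorem exists_J_srpg_sub_JStar_le [Nonempty A] (hρ : ρ ∈ stdSimplex ℝ S) (hρ_pos : ∀ s, 0 < ρ s)
    (hk : 1 ≤ k) (hl : 0 ≤ l) {σ₀ ε : ℝ} (hσ₀ : 0 < σ₀) (hε : 0 < ε)
    {θ₀ : EuclideanSpace ℝ (S × A)} (hθ₀ : θ₀ ∈ directParams S A) :
    ∃ t < M.iterations ρ k l (M.smoothing σ₀ ε) ε,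
      M.J ρ (M.srpg ρ (M.smoothing σ₀ ε) (1 / M.Lσ k l (M.smoothing σ₀ ε)) θ₀ t) - M.JStar ρ ≤
        3 * ε := by
  have hσ := smoothing_pos (M := M) hσ₀ hε
  have hbias := smoothing_bias_le (M := M) (σ₀ := σ₀) hε
  set σ := M.smoothing σ₀ ε
  obtain ⟨hLC, hLc⟩ := Lσ_bounds (M := M) hσ hk hl
  -- A competitor within ε of the infimum suffices, so attainment is not needed. The errors are ε
  -- here, ε from optimization and ε/2 from smoothing.
  obtain ⟨_, ⟨y, hy, rfl⟩, hyJ⟩ := exists_lt_of_csInf_lt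
    ((directParams_nonempty (S := S) (A := A)).image (M.J ρ))
    (lt_add_of_pos_right (M.JStar ρ) hε)
  obtain ⟨t, ht, h⟩ := exists_Jσ_srpg_sub_le hρ hρ_pos hσ hLC hLc hε hθ₀ hy (Nat.le_ceil _)
  refine ⟨t, ht, ?_⟩
  have h1 := J_le_Jσ (M := M) hρ hσ (srpg_mem (M := M) ρ σ (1 / M.Lσ k l σ) hθ₀ t)
  have h2 := Jσ_le_J_add (M := M) hρ hσ hy
  linarith

end

/-! ### Rates -/

lemma kB_isBigO (M : RobustMDP S A) (σ₀ k l : ℝ) :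
    (fun ε : ℝ => M.kB k l (M.smoothing σ₀ ε)) =O[𝓝[>] 0] fun _ : ℝ => (1 : ℝ) := by
  refine ((M.Cσ_isBigO σ₀).const_mul_left (1 / (1 - M.β) * (Fintype.card A * l +
    Fintype.card A * k * (1 / (1 - M.γ) * Fintype.card A * k)) +
      2 * (Fintype.card A : ℝ) ^ 2 * M.β * (1 / (1 - M.β)) ^ 2 * k ^ 2)).congr_left fun ε => ?_
  rw [kB_eq, CVσ]
  ring

/-- With `Cσ` and `kB` bounded, only the explicit factor σ grows as ε → 0. -/
lemma Lσ_isBigO (M : RobustMDP S A) (σ₀ k l : ℝ) :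
    (fun ε : ℝ => M.Lσ k l (M.smoothing σ₀ ε)) =O[𝓝[>] 0] fun ε : ℝ => ε⁻¹ := by
  have hC := M.Cσ_isBigO σ₀
  have hB := (M.kB_isBigO σ₀ k l).trans one_isBigO_inv
  have hσC : (fun ε : ℝ => M.smoothing σ₀ ε * (M.Cσ (M.smoothing σ₀ ε) *
      M.Cσ (M.smoothing σ₀ ε))) =O[𝓝[>] 0] fun ε : ℝ => ε⁻¹ := by
    simpa using (M.smoothing_isBigO σ₀).mul (hC.mul hC)
  refine (hB.add (((hB.const_mul_left (Real.sqrt (Fintype.card S))).add (hσC.const_mul_left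
    (2 * Fintype.card S * (1 / (1 - M.γ) * Fintype.card A * k) * (1 / (1 - M.γ + M.γ * M.R)) * k *
      Fintype.card A))).const_mul_left (M.γ * M.R / (1 - M.γ)))).congr_left fun ε => ?_
  rw [Lσ, CVσ]
  ring

lemma iterations_isBigO (M : RobustMDP S A) (ρ : S → ℝ) (σ₀ k l : ℝ) :
    (fun ε : ℝ => (M.iterations ρ k l (M.smoothing σ₀ ε) ε : ℝ)) =O[𝓝[>] 0]
      fun ε : ℝ => (ε ^ 3)⁻¹ := by
  have hX : (fun ε : ℝ => 64 * Fintype.card S * M.CPL ρ ^ 2 * M.Lσ k l (M.smoothing σ₀ ε) *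
      M.Cσ (M.smoothing σ₀ ε) / ε ^ 2) =O[𝓝[>] 0] fun ε : ℝ => (ε ^ 3)⁻¹ := by
    refine ((((M.Lσ_isBigO σ₀ k l).mul (M.Cσ_isBigO σ₀)).mul
      (isBigO_refl (fun ε : ℝ => (ε ^ 2)⁻¹) _)).const_mul_left
        (64 * Fintype.card S * M.CPL ρ ^ 2)).congr (fun ε => ?_) fun ε => ?_
    · ring
    · rw [mul_one, ← mul_inv]
      ring
  have h1 : (fun _ : ℝ => (1 : ℝ)) =O[𝓝[>] 0] fun ε : ℝ => (ε ^ 3)⁻¹ := by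
    simpa [← inv_pow] using one_isBigO_inv.pow 3
  -- Rounding up costs at most 1, which is itself O(ε⁻³). The absolute value is needed because k and
  -- l carry no sign here.
  refine IsBigO.trans (IsBigO.of_bound 1 (Eventually.of_forall fun ε => ?_)) (hX.norm_left.add h1)
  rw [iterations, one_mul, Real.norm_natCast, Real.norm_of_nonneg (by positivity)]
  set x := 64 * Fintype.card S * M.CPL ρ ^ 2 * M.Lσ k l (M.smoothing σ₀ ε) *
    M.Cσ (M.smoothing σ₀ ε) / ε ^ 2
  rcases le_total 0 x with hx | hx
  · exact (Nat.ceil_lt_add_one hx).le.trans (add_le_add_left (le_abs_self x) 1)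
  · rw [Nat.ceil_eq_zero.2 hx, Nat.cast_zero]
    positivity

end RobustMDP

end

end RobustPG

end

theorem theorem6 {S A : Type*} [Fintype S] [Nonempty S] [Fintype A] [Nonempty A]
    (M : RobustPG.RobustMDP S A)
    (ρ : S → ℝ) (hρ : ρ ∈ stdSimplex ℝ S) (hρ_pos : ∀ s, 0 < ρ s)
    (k l : ℝ)
    (hk : RobustPG.IsLipschitzPolicyClass (RobustPG.directParams S A)
      (RobustPG.directPolicy (S := S) (A := A)) k)
    (hl : RobustPG.IsSmoothPolicyClass (RobustPG.directParams S A)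
      (RobustPG.directPolicy (S := S) (A := A)) l)
    (σ₀ : ℝ) (hσ₀ : 0 < σ₀) :
    (∀ ε : ℝ, 0 < ε → ∀ θ₀ ∈ RobustPG.directParams S A,
      ∃ t < M.iterations ρ k l (M.smoothing σ₀ ε) ε,
        M.J ρ (M.srpg ρ (M.smoothing σ₀ ε) (1 / M.Lσ k l (M.smoothing σ₀ ε)) θ₀ t)
          - M.JStar ρ ≤ 3 * ε) ∧
    (fun ε : ℝ => M.smoothing σ₀ ε) =O[𝓝[>] 0] (fun ε : ℝ => ε⁻¹) ∧
    (fun ε : ℝ => (M.iterations ρ k l (M.smoothing σ₀ ε) ε : ℝ)) =O[𝓝[>] 0]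
      (fun ε : ℝ => (ε ^ 3)⁻¹) :=
  ⟨fun _ hε _ hθ₀ =>
    RobustPG.RobustMDP.exists_J_srpg_sub_JStar_le hρ hρ_pos hk.one_le hl.1 hσ₀ hε hθ₀,
    M.smoothing_isBigO σ₀, M.iterations_isBigO ρ σ₀ k l⟩
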